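/- **Setting.** Let $\mathcal M=(E,\mathcal I)$ be a loopless matroid of rank $2$ on a finite ground set with $n=|E|$ elements. In the ordinal matroid secretary problem (MSP), the matroid is known in advance, there is an unknown total order $\succ$ on $E$ (the value order), and the elements arrive in a uniformly random order. When an element arrives, its identity and its comparisons with the elements that arrived before are revealed, and it must be irrevocably selected or rejected; the selected set must be independent. For $S\subseteq E$, $\mathrm{OPT}(S)$ denotes the unique independent subset of $S$ that is lexicographically maximal with respect to $\succ$. A randomized algorithm is $\alpha$-probability-competitive if, for every value order, each element of $\mathrm{OPT}(E)$ is selected with probability at least $\alpha$. **The algorithms.** Fix $p,\varepsilon\in(0,1)$. The algorithm draws $n$ independent uniform times in $[0,1]$, sorts them, and assigns the $i$-th smallest one as the arrival time of the $i$-th arriving element. Let $E_p$ be the set of elements with arrival time less than $p$; these are all skipped. An element $e$ is improving if $e\in\mathrm{OPT}(X)$, where $X$ is the set of elements that have arrived so far, including $e$. Two elements are parallel if they form a circuit of size two. * *Greedy-Improving* selects, in arrival order, each improving element with arrival time in $[p,1]$ whose addition keeps the selected set independent. * *Oblivious-Partition* lets $C_1$ be the parallel class of the best element (with respect to $\succ$)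 of $\mathrm{OPT}(E_p)$ ($C_1=\emptyset$ if $\mathrm{OPT}(E_p)=\emptyset$), and selects the first improving element with arrival time in $[p,1]$ that lies in $C_1$ and the first improving element with arrival time in $[p,1]$ that does not lie in $C_1$ (whenever they exist). * *Mixture* runs Oblivious-Partition with probability $\varepsilon$ and Greedy-Improving otherwise. **Theorem.** There is a $0.3462$-probability-competitive algorithm for the MSP on rank-$2$ matroids. Namely, for every loopless matroid of rank $2$ on a finite ground set, Mixture with $p=0.4067$ and $\varepsilon=0.3928$ is an algorithm for the ordinal MSP that is $0.3462$-probability-competitive. -/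

import Mathlib

open Set MeasureTheory

namespace MSP

/-! ### Matroids with a value order

A value order is a linear order `L` on the ground set; `L.lt f e` means that `e` is better than `f`
(that is, `e ≻ f`). -/

/-- Two elements are parallel if they form a circuit of size two. -/
def Parallel {E : Type*} (M : Matroid E) (e f : E) : Prop :=
  e ≠ f ∧ M.IsCircuit {e, f}

/-- `I` is lexicographically strictly better than `J` with respect to the value order: the
best element of the symmetric difference of `I` and `J` belongs to `I`. -/
def LexBetter {E : Type*} (L : LinearOrder E) (I J : Set E) : Prop :=
  ∃ e ∈ I \ J, ∀ f ∈ J \ I, L.lt f e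

/-- `I` is the lexicographically maximal independent subset of `S`. -/
def IsLexMaximalIndep {E : Type*} (M : Matroid E) (L : LinearOrder E) (S I : Set E) : Prop :=
  M.Indep I ∧ I ⊆ S ∧ ∀ J, M.Indep J → J ⊆ S → J ≠ I → LexBetter L I J

/-- `OPT(S)`: the lexicographically maximal independent subset of `S`
(it exists and is unique on a finite ground set). -/
def opt {E : Type*} (M : Matroid E) (L : LinearOrder E) (S : Set E) : Set E :=
  {e | ∃ I, IsLexMaximalIndep M L S I ∧ e ∈ I}

/-! ### Algorithms for the ordinal matroid secretary problem -/

/-- An arrival order: `σ i` is the element that arrives in position `i`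
(positions are counted from `0`). -/
abbrev Arrival (E : Type*) [Fintype E] := Fin (Fintype.card E) ≃ E

/-- A randomized procedure: it draws a seed `ω` according to `law` and, on the value order `L`
and the arrival order `σ`, selects the set `output ω L σ`. -/
structure RandomizedProcedure (E : Type*) [Fintype E] where
  Seed : Type
  [measurableSpaceSeed : MeasurableSpace Seed]
  law : Measure Seed
  output : Seed → LinearOrder E → Arrival E → Set E

attribute [instance] RandomizedProcedure.measurableSpaceSeed

/-- The procedure is online and irrevocable in the ordinal model: whether the element arriving in
position `i` is selected is determined by the seed, the identities of the elements in positions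
`0, …, i`, and the comparisons among these elements. -/
def RandomizedProcedure.IsOnline {E : Type*} [Fintype E] (A : RandomizedProcedure E) : Prop :=
  ∀ (ω : A.Seed) (L L' : LinearOrder E) (σ σ' : Arrival E) (i : Fin (Fintype.card E)),
    (∀ j ≤ i, σ j = σ' j) →
    (∀ j ≤ i, ∀ k ≤ i, (L.lt (σ j) (σ k) ↔ L'.lt (σ j) (σ k))) →
    (σ i ∈ A.output ω L σ ↔ σ' i ∈ A.output ω L' σ')

/-- `A` is an algorithm for the ordinal matroid secretary problem on the matroid `M`. -/
structure RandomizedProcedure.IsMSPAlgorithm {E : Type*} [Fintype E]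
    (A : RandomizedProcedure E) (M : Matroid E) : Prop where
  isProbabilityMeasure : IsProbabilityMeasure A.law
  measurableSet_mem_output : ∀ (L : LinearOrder E) (σ : Arrival E) (e : E),
    MeasurableSet {ω | e ∈ A.output ω L σ}
  online : A.IsOnline
  indep_output : ∀ (ω : A.Seed) (L : LinearOrder E) (σ : Arrival E), M.Indep (A.output ω L σ)

open scoped Classical in
/-- The probability that `e` is selected, when the elements arrive in a uniformly random order
that is independent of the seed of the algorithm. -/
noncomputable def RandomizedProcedure.selectionProb {E : Type*} [Fintype E]
    (A : RandomizedProcedure E) (L : LinearOrder E) (e : E) : ℝ :=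
  (∑ σ : Arrival E, A.law.real {ω | e ∈ A.output ω L σ}) / (Nat.factorial (Fintype.card E) : ℝ)

/-- `A` is `α`-probability-competitive on `M`: for every value order, every optimal element is
selected with probability at least `α`. -/
def RandomizedProcedure.IsProbabilityCompetitive {E : Type*} [Fintype E]
    (A : RandomizedProcedure E) (M : Matroid E) (α : ℝ) : Prop :=
  ∀ (L : LinearOrder E) (e : E), e ∈ opt M L M.E → α ≤ A.selectionProb L e

/-! ### Simulated arrival times and improving elements -/

/-- The arrival time of `e`: the times `τ` drawn by the algorithm are sorted increasingly and the
`i`-th smallest one is assigned to the element arriving in position `i`. -/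
noncomputable def arrivalTime {E : Type*} [Fintype E] (τ : Fin (Fintype.card E) → unitInterval)
    (σ : Arrival E) (e : E) : ℝ :=
  ((τ (Tuple.sort τ (σ.symm e)) : unitInterval) : ℝ)

/-- The sample `E_p`: the elements with arrival time smaller than `p`. -/
def sample {E : Type*} [Fintype E] (p : ℝ) (τ : Fin (Fintype.card E) → unitInterval)
    (σ : Arrival E) : Set E :=
  {e | arrivalTime τ σ e < p}

/-- The elements that have arrived when `e` arrives, including `e`. -/
def arrivedUpTo {E : Type*} [Fintype E] (σ : Arrival E) (e : E) : Set E :=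
  {f | σ.symm f ≤ σ.symm e}

/-- `e` is improving: it belongs to the optimum of the elements that have arrived so far. -/
def IsImproving {E : Type*} [Fintype E] (M : Matroid E) (L : LinearOrder E)
    (σ : Arrival E) (e : E) : Prop :=
  e ∈ opt M L (arrivedUpTo σ e)

/-- The improving elements with arrival time in `[p, 1]`. -/
def candidates {E : Type*} [Fintype E] (M : Matroid E) (p : ℝ)
    (τ : Fin (Fintype.card E) → unitInterval) (L : LinearOrder E) (σ : Arrival E) : Set E :=
  {e | p ≤ arrivalTime τ σ e ∧ IsImproving M L σ e}

/-! ### Greedy-Improving -/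

open scoped Classical in
/-- The set selected by Greedy-Improving after the first `k` arrivals. -/
noncomputable def greedySet {E : Type*} [Fintype E] (M : Matroid E) (p : ℝ)
    (τ : Fin (Fintype.card E) → unitInterval) (L : LinearOrder E) (σ : Arrival E) : ℕ → Set E
  | 0 => ∅
  | k + 1 =>
    if h : k < Fintype.card E then
      if σ ⟨k, h⟩ ∈ candidates M p τ L σ ∧
          M.Indep (insert (σ ⟨k, h⟩) (greedySet M p τ L σ k)) then
        insert (σ ⟨k, h⟩) (greedySet M p τ L σ k)
      else greedySet M p τ L σ k
    else greedySet M p τ L σ k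

/-- The output of Greedy-Improving with sample size `p`. -/
noncomputable def greedyImproving {E : Type*} [Fintype E] (M : Matroid E) (p : ℝ)
    (τ : Fin (Fintype.card E) → unitInterval) (L : LinearOrder E) (σ : Arrival E) : Set E :=
  greedySet M p τ L σ (Fintype.card E)

/-! ### Oblivious-Partition -/

/-- The part `C₁`: the parallel class of the best element `g` of `OPT(E_p)`
(it is empty if `OPT(E_p)` is empty). -/
def firstClass {E : Type*} [Fintype E] (M : Matroid E) (p : ℝ)
    (τ : Fin (Fintype.card E) → unitInterval) (L : LinearOrder E) (σ : Arrival E) : Set E :=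
  {e | ∃ g ∈ opt M L (sample p τ σ), (∀ h ∈ opt M L (sample p τ σ), h ≠ g → L.lt h g) ∧
    (e = g ∨ Parallel M e g)}

/-- The first element of `S` to arrive, as a set with at most one element. -/
def firstArriving {E : Type*} [Fintype E] (σ : Arrival E) (S : Set E) : Set E :=
  {e | e ∈ S ∧ ∀ f ∈ S, σ.symm e ≤ σ.symm f}

/-- The output of Oblivious-Partition with sample size `p`: the first improving element arriving in
`[p, 1]` that lies in `C₁`, and the first improving element arriving in `[p, 1]` that does not. -/
def obliviousPartition {E : Type*} [Fintype E] (M : Matroid E) (p : ℝ)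
    (τ : Fin (Fintype.card E) → unitInterval) (L : LinearOrder E) (σ : Arrival E) : Set E :=
  firstArriving σ (candidates M p τ L σ ∩ firstClass M p τ L σ) ∪
    firstArriving σ (candidates M p τ L σ \ firstClass M p τ L σ)

/-! ### The mixture -/

open scoped Classical in
/-- The mixture with sample size `p`: it draws independent uniform times `τ` in `[0, 1]` and an
independent uniform coin `u` in `[0, 1]`; with probability `ε` (namely, if `u < ε`) it runs
Oblivious-Partition, and otherwise Greedy-Improving. -/
noncomputable def mixture {E : Type*} [Fintype E] (M : Matroid E) (p ε : ℝ) :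
    RandomizedProcedure E where
  Seed := unitInterval × (Fin (Fintype.card E) → unitInterval)
  law := volume
  output ω L σ :=
    if (ω.1 : ℝ) < ε then obliviousPartition M p ω.2 L σ else greedyImproving M p ω.2 L σ

end MSP

/-! Fix a value order and `e` in OPT(E). The sorted times assigned along a uniformly random order
are distributed as independent uniform arrival times of the elements, so one may condition on `e`
arriving at a time t ≥ p. Let A be the set arriving before t and O = OPT(A). Then |O| ≤ 2, and at
most one element of O is parallel to `e`; let φ(t) be the probability that there is one. Since `e`
stays in the optimum of every set containing it, `e` is improving, and only earlier selections can
block it.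

Oblivious-Partition takes `e` when O lies in the sample, which has conditional probability at least
(p/t)^2. It also takes `e` as soon as an element of O parallel to `e` is sampled, which has
probability p/t. This gives φ·p/t + (1-φ)(p/t)^2 (`oblivious_lower_bound_at`).

Greedy-Improving takes `e` when O lies in the sample. It also does so when the last element f of O
arrives at some s in [p, t), f is not parallel to `e`, and the optimum of what precedes f is
sampled: then f is the only possible candidate before `e`. For |O| = 2 each eligible f contributes ∫
(1/t)(s/t)(p/s)^2 ds over [p, t], that is (p/t)^2 log(t/p), and there are two such f, or one if O
meets the class of `e`. A smaller O only helps. This gives (p/t)^2 (1 + (2-φ) log(t/p))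
(`greedy_lower_bound_at`).

The function φ depends on the matroid, but the mixed bound is affine in φ ∈ [0,1], hence at least
the smaller of its values at φ = 1 (`meetBound`) and φ = 0 (`avoidBound`). With u = t/p their
difference has the sign of ε(u-1) - (1-ε) log u, negative from u = 1 up to about u = 2.26 and
positive afterwards. Integrating the smaller one in closed form gives the constant
(`mixture_integral_bound`). -/

namespace MSP

/-! ### The optimum as the greedy basis. -/

section Opt

variable {E : Type*}

/-- The elements of `S` that are not spanned by the better elements of `S`. -/
def greedyBasis (M : Matroid E) (L : LinearOrder E) (S : Set E) : Set E :=
  {e | e ∈ S ∧ e ∉ M.closure {f | f ∈ S ∧ L.lt e f}}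

lemma greedyBasis_subset (M : Matroid E) (L : LinearOrder E) (S : Set E) :
    greedyBasis M L S ⊆ S := fun _ h => h.1

lemma lt_irrefl' (L : LinearOrder E) (a : E) : ¬ L.lt a a := by
  let := L
  exact lt_irrefl a

lemma lt_trans' (L : LinearOrder E) {a b c : E} (h : L.lt a b) (h' : L.lt b c) : L.lt a c := by
  let := L
  exact lt_trans (a := a) h h'

lemma lt_trichotomy' (L : LinearOrder E) (a b : E) : L.lt a b ∨ a = b ∨ L.lt b a := by
  let := L
  exact lt_trichotomy a b

lemma exists_max' (L : LinearOrder E) [Finite E] {S : Set E} (hS : S.Nonempty) :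
    ∃ d ∈ S, ∀ f ∈ S, f ≠ d → L.lt f d := by
  let := L
  obtain ⟨d, hd, hmax⟩ := S.toFinite.exists_maximalFor id S hS
  refine ⟨d, hd, fun f hf hne => ?_⟩
  rcases lt_trichotomy' L f d with h | h | h
  · exact h
  · exact absurd h hne
  · have h1 : f ≤ d := hmax hf (le_of_lt (a := d) h)
    exact absurd h (not_lt_of_ge h1)

/-- Induction from the best element downwards: a rejected element is spanned by better ones, and
each of these is spanned by accepted elements no worse than itself. -/
lemma mem_closure_greedyBasis [Finite E] {M : Matroid E} (hE : M.E = univ) (L : LinearOrder E)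
    {S : Set E} {e : E} (he : e ∈ S) :
    e ∈ M.closure {f | f ∈ greedyBasis M L S ∧ ¬ L.lt f e} := by
  let := L
  induction e using WellFoundedGT.induction with
  | ind e ih =>
    by_cases heG : e ∈ greedyBasis M L S
    · exact M.mem_closure_of_mem ⟨heG, lt_irrefl' L e⟩ (by simp [hE])
    · have h1 : e ∈ M.closure {f | f ∈ S ∧ L.lt e f} := by
        by_contra h
        exact heG ⟨he, h⟩
      refine M.closure_subset_closure_of_subset_closure ?_ h1
      rintro f ⟨hfS, hf⟩
      refine M.closure_subset_closure ?_ (ih f hf hfS)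
      rintro k ⟨hk, hkf⟩
      exact ⟨hk, fun h => hkf (lt_trans' L h hf)⟩

lemma closure_above_greedyBasis [Finite E] {M : Matroid E} (hE : M.E = univ) (L : LinearOrder E)
    (S : Set E) (d : E) :
    M.closure {f | f ∈ greedyBasis M L S ∧ L.lt d f} = M.closure {f | f ∈ S ∧ L.lt d f} := by
  apply subset_antisymm
  · exact M.closure_subset_closure fun f hf => ⟨hf.1.1, hf.2⟩
  · refine M.closure_subset_closure_of_subset_closure ?_
    rintro f ⟨hf, hdf⟩
    refine M.closure_subset_closure ?_ (mem_closure_greedyBasis hE L hf)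
    rintro k ⟨hk, hkf⟩
    refine ⟨hk, ?_⟩
    rcases lt_trichotomy' L k f with h | h | h
    · exact absurd h hkf
    · exact h ▸ hdf
    · exact lt_trans' L hdf h

lemma indep_greedyBasis [Finite E] {M : Matroid E} (hE : M.E = univ) (L : LinearOrder E)
    (S : Set E) : M.Indep (greedyBasis M L S) := by
  by_contra h
  rw [Matroid.not_indep_iff (by simp [hE])] at h
  obtain ⟨K, hK, hcirc⟩ := h.exists_isCircuit_subset
  -- The maximum in the dual order is the worst element of the circuit; it is spanned by the others,
  -- which are all better.
  obtain ⟨d, hd, hmin⟩ := exists_max' (@OrderDual.instLinearOrder E L) hcirc.nonempty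
  refine (hK hd).2 (M.closure_subset_closure ?_ (hcirc.mem_closure_sdiff_singleton_of_mem hd))
  rintro f ⟨hf, hfd⟩
  exact ⟨(hK hf).1, hmin f hf hfd⟩

lemma lexBetter_greedyBasis [Finite E] {M : Matroid E} (hE : M.E = univ) (L : LinearOrder E)
    {S J : Set E} (hJ : M.Indep J) (hJS : J ⊆ S) (hne : J ≠ greedyBasis M L S) :
    LexBetter L (greedyBasis M L S) J := by
  have hnon : (symmDiff (greedyBasis M L S) J).Nonempty := by
    rw [Set.nonempty_iff_ne_empty]
    intro h
    exact hne (symmDiff_eq_bot.1 h).symm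
  obtain ⟨d, hd, hmax⟩ := exists_max' L hnon
  rcases hd with hd | hd
  · refine ⟨d, hd, fun f hf => hmax f (Or.inr hf) ?_⟩
    rintro rfl
    exact hd.2 hf.1
  -- If the best disagreement d were in J only, the better greedy elements, all in J, would span d,
  -- contradicting independence of J.
  · exfalso
    have h1 : d ∈ M.closure {f | f ∈ S ∧ L.lt d f} := by
      by_contra h
      exact hd.2 ⟨hJS hd.1, h⟩
    rw [← closure_above_greedyBasis hE] at h1
    refine hJ.notMem_closure_sdiff_of_mem hd.1 (M.closure_subset_closure ?_ h1)
    rintro f ⟨hf, hdf⟩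
    have hfd : f ≠ d := by
      rintro rfl
      exact lt_irrefl' L _ hdf
    refine ⟨?_, hfd⟩
    by_contra hfJ
    exact lt_irrefl' L _ (lt_trans' L hdf (hmax f (Or.inl ⟨hf, hfJ⟩) hfd))

lemma LexBetter.asymm {L : LinearOrder E} {I J : Set E} (h : LexBetter L I J) :
    ¬ LexBetter L J I := by
  rintro ⟨f, hf, hf'⟩
  obtain ⟨e, he, he'⟩ := h
  exact lt_irrefl' L _ (lt_trans' L (he' f hf) (hf' e he))

/-- The optimum is computed by the greedy rule. -/
lemma opt_eq_greedyBasis [Finite E] {M : Matroid E} (hE : M.E = univ) (L : LinearOrder E)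
    (S : Set E) : opt M L S = greedyBasis M L S := by
  have hG : IsLexMaximalIndep M L S (greedyBasis M L S) :=
    ⟨indep_greedyBasis hE L S, greedyBasis_subset M L S,
      fun J hJ hJS hne => lexBetter_greedyBasis hE L hJ hJS hne⟩
  ext e
  constructor
  · rintro ⟨I, hI, he⟩
    by_cases h : I = greedyBasis M L S
    · exact h ▸ he
    · exact absurd (hG.2.2 I hI.1 hI.2.1 h)
        (hI.2.2 _ hG.1 hG.2.1 (Ne.symm h)).asymm
  · intro he
    exact ⟨_, hG, he⟩

variable [Finite E] {M : Matroid E} (hE : M.E = univ) {L : LinearOrder E}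

include hE

lemma mem_opt {S : Set E} {e : E} :
    e ∈ opt M L S ↔ e ∈ S ∧ e ∉ M.closure {f | f ∈ S ∧ L.lt e f} := by
  rw [opt_eq_greedyBasis hE]; rfl

lemma opt_subset (S : Set E) : opt M L S ⊆ S := fun _ h => ((mem_opt hE).1 h).1

lemma indep_opt (S : Set E) : M.Indep (opt M L S) := by
  rw [opt_eq_greedyBasis hE]
  exact indep_greedyBasis hE L S

lemma closure_above_opt (S : Set E) (d : E) :
    M.closure {f | f ∈ opt M L S ∧ L.lt d f} = M.closure {f | f ∈ S ∧ L.lt d f} := by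
  rw [opt_eq_greedyBasis hE]
  exact closure_above_greedyBasis hE L S d

/-- Removing elements can only shrink the span of the better ones. This is why an element of OPT(E)
is improving on arrival. -/
lemma mem_opt_of_subset {S T : Set E} (hST : S ⊆ T) {e : E} (he : e ∈ opt M L T) (heS : e ∈ S) :
    e ∈ opt M L S := by
  rw [mem_opt hE] at he ⊢
  exact ⟨heS, fun h => he.2 (M.closure_subset_closure (show {f | f ∈ S ∧ L.lt e f} ⊆ {f | f ∈ T ∧ L.lt e f}
    from fun f hf => ⟨hST hf.1, hf.2⟩) h)⟩

lemma opt_eq_of_subset {S T : Set E} (hST : S ⊆ T) (hT : opt M L T ⊆ S) :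
    opt M L S = opt M L T := by
  apply subset_antisymm
  · intro e he
    rw [mem_opt hE] at he ⊢
    refine ⟨hST he.1, fun h => he.2 ?_⟩
    rw [← closure_above_opt hE] at h
    exact M.closure_subset_closure (show {f | f ∈ opt M L T ∧ L.lt e f} ⊆ {f | f ∈ S ∧ L.lt e f}
      from fun f hf => ⟨hT hf.1, hf.2⟩) h
  · intro e he
    exact mem_opt_of_subset hE hST he (hT he)

/-- The optimum of `S` only depends on the comparisons within `S`. -/
lemma opt_congr {L' : LinearOrder E} {S : Set E}
    (h : ∀ a ∈ S, ∀ b ∈ S, (L.lt a b ↔ L'.lt a b)) : opt M L S = opt M L' S := by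
  ext e
  rw [mem_opt hE, mem_opt hE]
  refine and_congr_right fun he => ?_
  have : {f | f ∈ S ∧ L.lt e f} = {f | f ∈ S ∧ L'.lt e f} := by
    ext f
    exact and_congr_right fun hf => h e he f hf
  rw [this]

end Opt

/-! ### Parallelism as closure of a singleton in a loopless matroid of rank two. -/

section Parallel

variable {E : Type*} {M : Matroid E} (hE : M.E = univ) (hloop : M.Loopless)

include hE hloop

lemma indep_singleton (e : E) : M.Indep {e} :=
  M.subsingleton_indep Set.subsingleton_singleton (by simp [hE])

lemma parallel_iff_not_indep {e f : E} : Parallel M e f ↔ e ≠ f ∧ ¬ M.Indep {e, f} := by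
  refine and_congr_right fun hne => ⟨fun h => h.not_indep, fun h => ?_⟩
  rw [Matroid.not_indep_iff (by simp [hE])] at h
  obtain ⟨K, hK, hcirc⟩ := h.exists_isCircuit_subset
  have hnt := (Matroid.loopless_iff_forall_isCircuit.1 hloop) K hcirc
  have : K = {e, f} := by
    obtain ⟨a, ha, b, hb, hab⟩ := hnt
    apply subset_antisymm hK
    have ha' := hK ha
    have hb' := hK hb
    simp only [mem_insert_iff, mem_singleton_iff] at ha' hb'
    rintro x (rfl | rfl) <;> grind
  exact this ▸ hcirc

lemma eq_or_parallel_iff {e f : E} : e = f ∨ Parallel M e f ↔ e ∈ M.closure {f} := by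
  rw [parallel_iff_not_indep hE hloop, (indep_singleton hE hloop f).mem_closure_iff',
    mem_singleton_iff]
  have : e ∈ M.E := by simp [hE]
  tauto

lemma mem_closure_singleton_symm {e f : E} (h : e ∈ M.closure {f}) : f ∈ M.closure {e} := by
  rw [← eq_or_parallel_iff hE hloop, parallel_iff_not_indep hE hloop] at h ⊢
  rw [Set.pair_comm f e]
  tauto

omit hE hloop in
lemma mem_closure_singleton_trans {e f g : E} (h : e ∈ M.closure {f}) (h' : f ∈ M.closure {g}) :
    e ∈ M.closure {g} :=
  M.closure_subset_closure_of_subset_closure (singleton_subset_iff.2 h') h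

lemma indep_pair {e f : E} (h : e ∉ M.closure {f}) : M.Indep {e, f} := by
  by_contra hn
  apply h
  rw [← eq_or_parallel_iff hE hloop, parallel_iff_not_indep hE hloop]
  tauto

lemma closure_pair_eq_univ (hrank : M.eRank = 2) {e f : E} (h : e ∉ M.closure {f}) :
    M.closure {e, f} = univ := by
  have hi := indep_pair hE hloop h
  obtain ⟨B, hB, hsub⟩ := hi.exists_isBase_superset
  have hef : e ≠ f := by
    rintro rfl
    exact h (M.mem_closure_self e (by simp [hE]))
  have hcard := hB.encard_eq_eRank
  have : ({e, f} : Set E) = B := by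
    have hfin : B.Finite := Set.finite_of_encard_le_coe (k := 2) (by rw [hcard, hrank]; rfl)
    exact (Set.toFinite _).eq_of_subset_of_encard_le hsub
      (by rw [hcard, hrank, Set.encard_pair hef])
  rw [this, hB.closure_eq, hE]

end Parallel

/-! ### Deterministic conditions under which the algorithms select an optimal element. -/

section Selection

variable {E : Type*} [Fintype E]

/-- `x` gives the (pairwise distinct) arrival times of the elements. -/
structure HasTimes (τ : Fin (Fintype.card E) → unitInterval) (σ : Arrival E)
    (x : E → unitInterval) : Prop where
  time_eq : ∀ y, arrivalTime τ σ y = x y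
  symm_le : ∀ y z, σ.symm y ≤ σ.symm z ↔ x y ≤ x z

variable {M : Matroid E} {L : LinearOrder E} {p : ℝ}
  {τ : Fin (Fintype.card E) → unitInterval} {σ : Arrival E} {x : E → unitInterval}

lemma greedySet_subset (k : ℕ) :
    greedySet M p τ L σ k ⊆ {y | y ∈ candidates M p τ L σ ∧ (σ.symm y : ℕ) < k} := by
  induction k with
  | zero => simp [greedySet]
  | succ k ih =>
    intro y hy
    rw [greedySet] at hy
    split_ifs at hy with h1 h2
    · rcases hy with rfl | hy
      · exact ⟨h2.1, by simp⟩
      · exact ⟨(ih hy).1, Nat.lt_succ_of_lt (ih hy).2⟩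
    · exact ⟨(ih hy).1, Nat.lt_succ_of_lt (ih hy).2⟩
    · exact ⟨(ih hy).1, Nat.lt_succ_of_lt (ih hy).2⟩

lemma greedySet_mono : Monotone (greedySet M p τ L σ) := by
  refine monotone_nat_of_le_succ fun k => ?_
  conv_rhs => rw [greedySet]
  split_ifs
  · exact subset_insert _ _
  · exact subset_rfl
  · exact subset_rfl

lemma indep_greedySet (k : ℕ) : M.Indep (greedySet M p τ L σ k) := by
  induction k with
  | zero => exact M.empty_indep
  | succ k ih =>
    rw [greedySet]
    split_ifs with h1 h2
    · exact h2.2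
    · exact ih
    · exact ih

/-- Whatever has been selected before `e` is among the earlier candidates, so independence with all
of them suffices. -/
lemma mem_greedyImproving {e : E} (he : e ∈ candidates M p τ L σ)
    (hind : M.Indep (insert e {y | y ∈ candidates M p τ L σ ∧ σ.symm y < σ.symm e})) :
    e ∈ greedyImproving M p τ L σ := by
  have hle : (σ.symm e : ℕ) + 1 ≤ Fintype.card E := (σ.symm e).2
  refine greedySet_mono hle ?_
  rw [greedySet]
  have h1 : (σ.symm e : ℕ) < Fintype.card E := (σ.symm e).2
  have h2 : σ ⟨(σ.symm e : ℕ), h1⟩ = e := by simp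
  rw [dif_pos h1, h2, if_pos]
  · exact mem_insert _ _
  · refine ⟨he, hind.subset (insert_subset_insert fun y hy => ?_)⟩
    exact greedySet_subset _ hy

lemma HasTimes.symm_lt (h : HasTimes τ σ x) (y z : E) : σ.symm y < σ.symm z ↔ x y < x z := by
  rw [← not_le, ← not_le, h.symm_le]

lemma HasTimes.mem_candidates (h : HasTimes τ σ x) (y : E) :
    y ∈ candidates M p τ L σ ↔ p ≤ x y ∧ y ∈ opt M L {z | x z ≤ x y} := by
  have : arrivedUpTo σ y = {z | x z ≤ x y} := by
    ext z
    exact h.symm_le z y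
  rw [candidates, mem_ofPred_eq, h.time_eq, IsImproving, this]

variable (hE : M.E = univ)

include hE

/-- If the optimum of the elements arriving before time `a` lies in the sample, then there is no
candidate before time `a`. -/
lemma HasTimes.le_of_mem_candidates (h : HasTimes τ σ x) {a : unitInterval}
    (ha : ∀ y ∈ opt M L {y | x y < a}, (x y : ℝ) < p) {y : E}
    (hy : y ∈ candidates M p τ L σ) : a ≤ x y := by
  rw [h.mem_candidates] at hy
  by_contra! hlt
  have hsub : {z | x z ≤ x y} ⊆ {z | x z < a} := fun z hz => lt_of_le_of_lt hz hlt
  -- The prefix at `y` already contains the whole sample, hence the optimum before `a`; so `y` would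
  -- belong to that optimum and be sampled.
  have heq := opt_eq_of_subset hE (L := L) hsub fun z hz => by
    have h1 : (x z : ℝ) < x y := (ha z hz).trans_le hy.1
    exact le_of_lt h1
  exact absurd (ha y (heq ▸ hy.2)) (not_lt_of_ge hy.1)

variable {e : E} (he : e ∈ opt M L M.E)

include he

lemma HasTimes.mem_candidates_of_mem_opt (h : HasTimes τ σ x) (hp : p ≤ x e) :
    e ∈ candidates M p τ L σ := by
  rw [h.mem_candidates]
  exact ⟨hp, mem_opt_of_subset hE (by simp [hE]) he (show x e ≤ x e from le_refl _)⟩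

omit hE he in
lemma mem_obliviousPartition_of_forall (hec : e ∈ candidates M p τ L σ)
    (h1 : e ∈ firstClass M p τ L σ → ∀ y ∈ candidates M p τ L σ,
      y ∈ firstClass M p τ L σ → σ.symm e ≤ σ.symm y)
    (h2 : e ∉ firstClass M p τ L σ → ∀ y ∈ candidates M p τ L σ,
      y ∉ firstClass M p τ L σ → σ.symm e ≤ σ.symm y) :
    e ∈ obliviousPartition M p τ L σ := by
  by_cases hc : e ∈ firstClass M p τ L σ
  · exact Or.inl ⟨⟨hec, hc⟩, fun f hf => h1 hc f hf.1 hf.2⟩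
  · exact Or.inr ⟨⟨hec, hc⟩, fun f hf => h2 hc f hf.1 hf.2⟩

lemma HasTimes.mem_obliviousPartition_of_opt_subset_sample (h : HasTimes τ σ x) (hp : p ≤ x e)
    (hA : ∀ y ∈ opt M L {y | x y < x e}, (x y : ℝ) < p) :
    e ∈ obliviousPartition M p τ L σ := by
  refine mem_obliviousPartition_of_forall (h.mem_candidates_of_mem_opt hE he hp) ?_ ?_
  · intro _ y hy _
    exact (h.symm_le _ _).2 (h.le_of_mem_candidates hE hA hy)
  · intro _ y hy _
    exact (h.symm_le _ _).2 (h.le_of_mem_candidates hE hA hy)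

variable (hloop : M.Loopless)

include hloop

lemma HasTimes.mem_greedyImproving_of_opt_subset_sample (h : HasTimes τ σ x) (hp : p ≤ x e)
    (hA : ∀ y ∈ opt M L {y | x y < x e}, (x y : ℝ) < p) :
    e ∈ greedyImproving M p τ L σ := by
  refine mem_greedyImproving (h.mem_candidates_of_mem_opt hE he hp) ?_
  refine (indep_singleton hE hloop e).subset ?_
  rintro y (rfl | ⟨hy, hlt⟩)
  · rfl
  · rw [h.symm_lt] at hlt
    exact absurd (h.le_of_mem_candidates hE hA hy) (not_le_of_gt hlt)

/-- If `f` is the only candidate before `e` and is not parallel to `e`, then Greedy-Improving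
selects `e`. -/
lemma HasTimes.mem_greedyImproving_of_unique (h : HasTimes τ σ x) (hp : p ≤ x e) {f : E}
    (hf : f ∈ opt M L {y | x y < x e}) (hfe : f ∉ M.closure {e})
    (hfirst : ∀ y ∈ opt M L {y | x y < x e}, y ≠ f → x y < x f)
    (hB : ∀ y ∈ opt M L {y | x y < x f}, (x y : ℝ) < p) :
    e ∈ greedyImproving M p τ L σ := by
  have hfx : x f < x e := opt_subset hE _ hf
  refine mem_greedyImproving (h.mem_candidates_of_mem_opt hE he hp) ?_
  refine (indep_pair hE hloop hfe).subset ?_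
  rintro y (rfl | ⟨hy, hlt⟩)
  · exact Or.inr rfl
  · left
    by_contra hne
    rw [h.symm_lt] at hlt
    have h1 : x f ≤ x y := h.le_of_mem_candidates hE hB hy
    rw [h.mem_candidates] at hy
    have hsub : {z | x z ≤ x y} ⊆ {z | x z < x e} := fun z hz => lt_of_le_of_lt hz hlt
    -- Once the last element `f` has arrived, the optimum up to `e` is complete, so a new candidate
    -- `y` would belong to it and come after `f`.
    have heq := opt_eq_of_subset hE (L := L) hsub fun z hz => by
      by_cases hzf : z = f
      · exact hzf ▸ h1
      · exact ((hfirst z hz hzf).trans_le h1).le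
    exact absurd (hfirst y (heq ▸ hy.2) hne) (not_lt_of_ge h1)

/-- If the optimum before `e` contains a sampled element parallel to `e`, then Oblivious-Partition
selects `e`. -/
lemma HasTimes.mem_obliviousPartition_of_parallel (hrank : M.eRank = 2) (h : HasTimes τ σ x)
    (hp : p ≤ x e) {g : E} (hg : g ∈ opt M L {y | x y < x e}) (hge : g ∈ M.closure {e})
    (hgp : (x g : ℝ) < p) :
    e ∈ obliviousPartition M p τ L σ := by
  have hsample : sample p τ σ = {y | (x y : ℝ) < p} := by
    ext y
    rw [sample, mem_ofPred_eq, h.time_eq]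
    rfl
  have hsub : {y | (x y : ℝ) < p} ⊆ {y | x y < x e} := fun y hy => by
    have : (x y : ℝ) < x e := lt_of_lt_of_le hy hp
    exact this
  have hgs : g ∈ opt M L (sample p τ σ) := by
    rw [hsample]
    exact mem_opt_of_subset hE hsub hg hgp
  obtain ⟨b, hb, hbmax⟩ := exists_max' L ⟨g, hgs⟩
  have hclass : ∀ y, y ∈ firstClass M p τ L σ ↔ y ∈ M.closure {b} := by
    intro y
    rw [← eq_or_parallel_iff hE hloop]
    constructor
    · rintro ⟨b', hb', hmax', hy⟩
      have : b' = b := by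
        by_contra hne
        exact lt_irrefl' L _ (lt_trans' L (hmax' b hb (Ne.symm hne)) (hbmax b' hb' hne))
      exact this ▸ hy
    · intro hy
      exact ⟨b, hb, hbmax, hy⟩
  refine mem_obliviousPartition_of_forall (h.mem_candidates_of_mem_opt hE he hp) ?_ ?_
  -- Here the first class is the common class of `e` and `g`. As `g` stays in every prefix optimum
  -- until `e`, no parallel `y` can be improving in between.
  · intro hec y hy hyc
    rw [hclass] at hec hyc
    rw [h.symm_le]
    by_contra! hlt
    rw [h.mem_candidates] at hy
    have hgY : g ∈ opt M L {z | x z ≤ x y} :=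
      mem_opt_of_subset hE (fun z hz => lt_of_le_of_lt hz hlt) hg
        (show (x g : ℝ) ≤ x y from (hgp.trans_le hy.1).le)
    have hyg : y ∈ M.closure {g} :=
      mem_closure_singleton_trans (mem_closure_singleton_trans hyc
        (mem_closure_singleton_symm hE hloop hec)) (mem_closure_singleton_symm hE hloop hge)
    have hne : y ≠ g := by
      rintro rfl
      exact absurd hgp (not_lt_of_ge hy.1)
    refine (indep_opt hE (L := L) {z | x z ≤ x y}).notMem_closure_sdiff_of_mem hy.2
      (M.closure_subset_closure ?_ hyg)
    exact singleton_subset_iff.2 ⟨hgY, hne.symm⟩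
  -- Here `b` is better than `g` and not parallel to it. Of `y` and `g`, both outside the first
  -- class, the worse one is spanned by `b` and the other, yet both lie in the optimum of the prefix
  -- at `y`.
  · intro hec y hy hyc
    rw [hclass] at hec hyc
    rw [h.symm_le]
    by_contra! hlt
    rw [h.mem_candidates] at hy
    have hgY : g ∈ opt M L {z | x z ≤ x y} :=
      mem_opt_of_subset hE (fun z hz => lt_of_le_of_lt hz hlt) hg
        (show (x g : ℝ) ≤ x y from (hgp.trans_le hy.1).le)
    have hbs : (x b : ℝ) < p := by
      have := opt_subset hE _ hb
      rwa [hsample] at this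
    have hbY : b ∈ {z | x z ≤ x y} := show (x b : ℝ) ≤ x y from (hbs.trans_le hy.1).le
    have hgb : g ≠ b := by
      rintro rfl
      exact hec (mem_closure_singleton_symm hE hloop hge)
    have hgb' : L.lt g b := hbmax g hgs hgb
    have hne : y ≠ g := by
      rintro rfl
      exact absurd hgp (not_lt_of_ge hy.1)
    rw [mem_opt hE] at hgY
    rcases lt_trichotomy' L y g with hyg | hyg | hyg
    · have hbg : b ∉ M.closure {g} := fun hbg =>
        hec (mem_closure_singleton_symm hE hloop (mem_closure_singleton_trans hbg hge))
      refine ((mem_opt hE).1 hy.2).2 (M.closure_subset_closure (X := {b, g}) ?_ ?_)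
      · rintro z (rfl | rfl)
        · exact ⟨hbY, lt_trans' L hyg hgb'⟩
        · exact ⟨hgY.1, hyg⟩
      · rw [closure_pair_eq_univ hE hloop hrank hbg]
        exact mem_univ y
    · exact hne hyg
    · refine hgY.2 (M.closure_subset_closure (X := {y, b}) ?_ ?_)
      · rintro z (rfl | rfl)
        · exact ⟨le_refl (x z), hyg⟩
        · exact ⟨hbY, hgb'⟩
      · rw [closure_pair_eq_univ hE hloop hrank hyc]
        exact mem_univ g

end Selection

/-! ### Product measure: resampling one coordinate, and volumes of boxes. -/

section Probability

open unitInterval Function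

variable {E : Type*} [Fintype E]

/-- Only the pieces need to be measurable: the selection events used later are arbitrary sets, so
bounds are stated for outer measure. -/
lemma sum_measure_inter_le {Ω κ : Type*} [MeasurableSpace Ω] (μ : Measure Ω) (S : Set Ω)
    (s : Finset κ) (D : κ → Set Ω) (hD : ∀ i ∈ s, MeasurableSet (D i))
    (hdisj : (s : Set κ).PairwiseDisjoint D) :
    ∑ i ∈ s, μ (S ∩ D i) ≤ μ S := by
  have h := sum_measure_le_measure_univ (μ := μ.restrict S) (s := s) (t := D)
    (fun i hi => (hD i hi).nullMeasurableSet)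
    (fun i hi j hj hij => (hdisj hi hj hij).aedisjoint)
  rw [Measure.restrict_apply_univ] at h
  refine le_trans (Finset.sum_le_sum fun i hi => ?_) h
  rw [Measure.restrict_apply (hD i hi), inter_comm]

lemma setLIntegral_unitInterval {a b : ℝ} (ha : 0 ≤ a) (hab : a ≤ b) (hb : b ≤ 1) {h : ℝ → ℝ}
    (hc : ContinuousOn h (Icc a b)) (hnn : ∀ t ∈ Icc a b, 0 ≤ h t) :
    ∫⁻ t in ((↑) : I → ℝ) ⁻¹' Ico a b, ENNReal.ofReal (h t) =
      ENNReal.ofReal (∫ t in a..b, h t) := by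
  have h1 := unitInterval.measurePreserving_coe.setLIntegral_comp_emb
    unitInterval.measurableEmbedding_coe (fun t => ENNReal.ofReal (h t))
    ((↑) ⁻¹' Ico a b)
  have himg : ((↑) : I → ℝ) '' ((↑) ⁻¹' Ico a b) = Ico a b := by
    rw [Subtype.image_preimage_coe, inter_eq_right]
    exact fun t ht => ⟨ha.trans ht.1, ht.2.le.trans hb⟩
  rw [himg, Measure.restrict_restrict measurableSet_Ico,
    inter_eq_left.2 (show Ico a b ⊆ I from fun t ht => ⟨ha.trans ht.1, ht.2.le.trans hb⟩)] at h1
  refine Eq.trans h1 ?_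
  rw [intervalIntegral.integral_of_le hab, ← integral_Ico_eq_integral_Ioc,
    ofReal_integral_eq_lintegral_ofReal]
  · exact (hc.integrableOn_Icc).mono_set Ico_subset_Icc_self
  · exact (ae_restrict_mem measurableSet_Ico).mono fun t ht => hnn t (Ico_subset_Icc_self ht)

variable [DecidableEq E]

lemma measurePreserving_update (e : E) :
    MeasurePreserving (fun z : (E → I) × I => update z.1 e z.2)
      ((volume : Measure (E → I)).prod (volume : Measure I)) volume := by
  have hm : Measurable (fun z : (E → I) × I => update z.1 e z.2) := by
    refine measurable_pi_iff.2 fun i => ?_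
    by_cases h : i = e
    · subst h; simpa using measurable_snd
    · simp only [update_of_ne h]
      exact (measurable_pi_apply i).comp measurable_fst
  refine ⟨hm, (Measure.pi_eq fun s hs => ?_).symm⟩
  rw [Measure.map_apply hm (MeasurableSet.univ_pi hs)]
  have : (fun z : (E → I) × I => update z.1 e z.2) ⁻¹' (pi univ s) =
      (pi univ (update s e univ)) ×ˢ (s e) := by
    ext ⟨x, t⟩
    simp only [mem_preimage, mem_pi, mem_univ, true_implies, mem_prod]
    constructor
    · refine fun h => ⟨fun i => ?_, by simpa using h e⟩
      by_cases hi : i = e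
      · subst hi; simp
      · simpa [hi] using h i
    · rintro ⟨h, he⟩ i
      by_cases hi : i = e
      · subst hi; simpa using he
      · simpa [hi] using h i
  rw [this, Measure.prod_prod, volume_pi, Measure.pi_pi,
    ← Finset.prod_erase_mul _ _ (Finset.mem_univ e),
    ← Finset.prod_erase_mul Finset.univ (fun i => (volume : Measure I) (s i)) (Finset.mem_univ e)]
  simp only [update_self, measure_univ, mul_one]
  congr 1
  refine Finset.prod_congr rfl fun i hi => ?_
  rw [update_of_ne (Finset.ne_of_mem_erase hi)]

/-- Conditioning on the time of `e`. Without measurability of `S` only this inequality is available,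
by Fubini applied to a measurable hull of `S`. -/
lemma lintegral_measure_update_le (e : E) (S : Set (E → I)) :
    ∫⁻ t : I, volume {x : E → I | update x e t ∈ S} ≤ volume S := by
  rw [← measure_toMeasurable S,
    ← (measurePreserving_update e).measure_preimage
      (measurableSet_toMeasurable volume S).nullMeasurableSet,
    Measure.prod_apply_symm ((measurePreserving_update e).measurable
      (measurableSet_toMeasurable volume S))]
  exact lintegral_mono fun t => measure_mono fun x hx => subset_toMeasurable _ _ hx

/-- Times below `p` on `O`, below `s` on `B`, in `[s, t)` on `A \ B`, at least `t` outside `A ∪ F`. -/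
def timeBox (O B A F : Finset E) (p s t : I) : Set (E → I) :=
  {x | (∀ y ∈ O, x y < p) ∧ (∀ y ∈ B, x y < s) ∧ (∀ y ∈ A \ B, s ≤ x y ∧ x y < t) ∧
    ∀ y ∉ A ∪ F, t ≤ x y}

omit [Fintype E] in
lemma timeBox_eq_pi {O B A F : Finset E} (hOB : O ⊆ B) (hBA : B ⊆ A)
    {p s t : I} (hps : p ≤ s) :
    timeBox O B A F p s t = pi univ (fun y => if y ∈ O then Iio p else if y ∈ B then Iio s else
      if y ∈ A then Ico s t else if y ∈ F then univ else Ici t) := by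
  ext x
  simp only [timeBox, mem_ofPred_eq, mem_pi, mem_univ, true_implies]
  constructor
  · rintro ⟨h1, h2, h3, h4⟩ y
    split_ifs with hO hB hA hF
    · exact h1 y hO
    · exact h2 y hB
    · exact h3 y (by simp [hA, hB])
    · trivial
    · exact h4 y (by simp [hA, hF])
  · intro h
    refine ⟨fun y hy => ?_, fun y hy => ?_, fun y hy => ?_, fun y hy => ?_⟩
    · have := h y
      simpa [hy] using this
    · have := h y
      by_cases hO : y ∈ O
      · simp only [hO, if_true, mem_Iio] at this
        exact this.trans_le hps
      · simpa [hy, hO] using this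
    · have := h y
      rw [Finset.mem_sdiff] at hy
      have hO : y ∉ O := fun h => hy.2 (hOB h)
      simpa [hy, hO] using this
    · have := h y
      rw [Finset.mem_union, not_or] at hy
      have hB : y ∉ B := fun h => hy.1 (hBA h)
      have hO : y ∉ O := fun h => hB (hOB h)
      simpa [hy, hO, hB] using this

lemma measurableSet_timeBox {O B A F : Finset E} (hOB : O ⊆ B) (hBA : B ⊆ A)
    {p s t : I} (hps : p ≤ s) : MeasurableSet (timeBox O B A F p s t) := by
  rw [timeBox_eq_pi hOB hBA hps]
  refine MeasurableSet.univ_pi fun y => ?_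
  split_ifs
  · exact measurableSet_Iio
  · exact measurableSet_Iio
  · exact measurableSet_Ico
  · exact MeasurableSet.univ
  · exact measurableSet_Ici

lemma volume_timeBox {O B A F : Finset E} (hOB : O ⊆ B) (hBA : B ⊆ A) (hF : Disjoint A F)
    {p s t : I} (hps : p ≤ s) (hst : s ≤ t) :
    volume (timeBox O B A F p s t) = ENNReal.ofReal ((p : ℝ) ^ O.card * (s : ℝ) ^ (B \ O).card *
      ((t : ℝ) - s) ^ (A \ B).card * (1 - (t : ℝ)) ^ (Finset.univ \ (A ∪ F)).card) := by
  have hst' : (s : ℝ) ≤ t := hst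
  rw [timeBox_eq_pi hOB hBA hps, volume_pi, Measure.pi_pi]
  have hvol : ∀ y : E, (volume : Measure I) (if y ∈ O then Iio p else if y ∈ B then Iio s else
      if y ∈ A then Ico s t else if y ∈ F then univ else Ici t) = ENNReal.ofReal
      (if y ∈ O then (p : ℝ) else if y ∈ B then (s : ℝ) else
      if y ∈ A then (t : ℝ) - s else if y ∈ F then 1 else 1 - (t : ℝ)) := by
    intro y
    split_ifs
    · exact unitInterval.volume_Iio p
    · exact unitInterval.volume_Iio s
    · exact unitInterval.volume_Ico s t
    · simp
    · exact unitInterval.volume_Ici t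
  simp only [hvol]
  rw [← ENNReal.ofReal_prod_of_nonneg]
  · congr 1
    rw [← Finset.prod_sdiff (Finset.subset_univ (A ∪ F)), Finset.prod_union hF,
      ← Finset.prod_sdiff hBA, ← Finset.prod_sdiff hOB]
    have e1 : ∀ y ∈ Finset.univ \ (A ∪ F), (if y ∈ O then (p : ℝ) else if y ∈ B then (s : ℝ) else
        if y ∈ A then (t : ℝ) - s else if y ∈ F then 1 else 1 - (t : ℝ)) = 1 - t := by
      intro y hy
      simp only [Finset.mem_sdiff, Finset.mem_univ, Finset.mem_union, true_and, not_or] at hy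
      have hB : y ∉ B := fun h => hy.1 (hBA h)
      have hO : y ∉ O := fun h => hB (hOB h)
      simp [hy, hB, hO]
    have e2 : ∀ y ∈ F, (if y ∈ O then (p : ℝ) else if y ∈ B then (s : ℝ) else
        if y ∈ A then (t : ℝ) - s else if y ∈ F then 1 else 1 - (t : ℝ)) = 1 := by
      intro y hy
      have hA : y ∉ A := fun h => Finset.disjoint_left.1 hF h hy
      have hB : y ∉ B := fun h => hA (hBA h)
      have hO : y ∉ O := fun h => hB (hOB h)
      simp [hy, hA, hB, hO]
    have e3 : ∀ y ∈ A \ B, (if y ∈ O then (p : ℝ) else if y ∈ B then (s : ℝ) else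
        if y ∈ A then (t : ℝ) - s else if y ∈ F then 1 else 1 - (t : ℝ)) = t - s := by
      intro y hy
      rw [Finset.mem_sdiff] at hy
      have hO : y ∉ O := fun h => hy.2 (hOB h)
      simp [hy, hO]
    have e4 : ∀ y ∈ B \ O, (if y ∈ O then (p : ℝ) else if y ∈ B then (s : ℝ) else
        if y ∈ A then (t : ℝ) - s else if y ∈ F then 1 else 1 - (t : ℝ)) = s := by
      intro y hy
      rw [Finset.mem_sdiff] at hy
      simp [hy]
    have e5 : ∀ y ∈ O, (if y ∈ O then (p : ℝ) else if y ∈ B then (s : ℝ) else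
        if y ∈ A then (t : ℝ) - s else if y ∈ F then 1 else 1 - (t : ℝ)) = p := by
      intro y hy
      simp [hy]
    rw [Finset.prod_congr rfl e1, Finset.prod_congr rfl e2, Finset.prod_congr rfl e3,
      Finset.prod_congr rfl e4, Finset.prod_congr rfl e5]
    simp only [Finset.prod_const]
    ring
  · intro y _
    split_ifs
    · exact p.2.1
    · exact s.2.1
    · linarith
    · exact zero_le_one
    · linarith [t.2.2]

end Probability

/-! ### Conditional probabilities given the set that precedes the optimal element. -/

section Conditional

open unitInterval Function

variable {E : Type*} [Fintype E] [DecidableEq E]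

/-- The probability that exactly the elements of `A` arrive before time `t`, given that `e` arrives
at time `t`. -/
def weight (e : E) (A : Finset E) (t : ℝ) : ℝ :=
  t ^ A.card * (1 - t) ^ (Finset.univ \ (insert e A)).card

lemma weight_nonneg (e : E) (A : Finset E) {t : ℝ} (h0 : 0 ≤ t) (h1 : t ≤ 1) :
    0 ≤ weight e A t :=
  mul_nonneg (pow_nonneg h0 _) (pow_nonneg (by linarith) _)

lemma sum_weight (e : E) (t : ℝ) :
    ∑ A ∈ (Finset.univ.erase e).powerset, weight e A t = 1 := by
  have h := Finset.sum_pow_mul_eq_add_pow t (1 - t) (Finset.univ.erase e)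
  rw [add_sub_cancel, one_pow] at h
  rw [← h]
  refine Finset.sum_congr rfl fun A hA => ?_
  rw [Finset.mem_powerset] at hA
  have heA : e ∉ A := fun h => by simpa using hA h
  rw [weight, ← Finset.card_sdiff_of_subset hA]
  congr 3
  ext y
  simp only [Finset.mem_sdiff, Finset.mem_univ, Finset.mem_insert, Finset.mem_erase]
  tauto

lemma ratio_pow_le {p s : ℝ} (hp : 0 < p) (hps : p ≤ s) {a b : ℕ} (hab : a ≤ b) :
    (p / s) ^ b ≤ (p / s) ^ a :=
  pow_le_pow_of_le_one (div_nonneg hp.le (hp.le.trans hps)) ((div_le_one (hp.trans_le hps)).2 hps) hab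

omit [Fintype E] in
lemma pow_card_mul_pow_card_sdiff {p s : ℝ} (hs : 0 < s) {O B : Finset E} (hOB : O ⊆ B) :
    p ^ O.card * s ^ (B \ O).card = (p / s) ^ O.card * s ^ B.card := by
  rw [← Finset.card_sdiff_add_card_eq_card hOB, pow_add, div_pow]
  field_simp

/-- With s = t and B = A the middle layer disappears: given that `A` precedes t, each of its
elements is sampled independently with probability p/t. -/
lemma volume_timeBox_sample {e : E} {A G : Finset E} (heA : e ∉ A) (hG : G ⊆ A) {p t : I}
    (hp : 0 < (p : ℝ)) (hpt : p ≤ t) :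
    volume (timeBox G A A {e} p t t) = ENNReal.ofReal (weight e A t * ((p : ℝ) / t) ^ G.card) := by
  have ht : (0 : ℝ) < t := hp.trans_le hpt
  rw [volume_timeBox hG subset_rfl (by simpa using heA) hpt le_rfl,
    pow_card_mul_pow_card_sdiff ht hG, weight]
  congr 1
  rw [Finset.union_comm, ← Finset.insert_eq]
  simp
  ring

variable {O : Finset E → Finset E} (hO : ∀ A, O A ⊆ A) (hcard : ∀ A, (O A).card ≤ 2)

include hO hcard

/-- The time of `f` is frozen at s. Sum over the sets B preceding s: the optimum of B is sampled
with probability at least (p/s)^2, and the binomial theorem collapses s and t - s to t. With |G| = 1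
the final estimate is an equality; with G empty it uses 1/t ≤ 1/s. -/
lemma weight_le_volume_of_update {e f : E} {A G : Finset E} (heA : e ∉ A) (hf : f ∈ A)
    (hG : G ⊆ A.erase f) (hG1 : G.card ≤ 1) {p s t : I} (hp : 0 < (p : ℝ)) (hps : p ≤ s)
    (hst : s < t) {R : Set (E → I)}
    (hR : ∀ B, G ⊆ B → B ⊆ A.erase f → timeBox (O B) B (A.erase f) {e, f} p s t ⊆ R) :
    ENNReal.ofReal (weight e A t * (((p : ℝ) / t) ^ 2 * (s : ℝ)⁻¹)) ≤ volume R := by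
  have hps' : (p : ℝ) ≤ s := hps
  have hst' : (s : ℝ) < t := hst
  have hs : (0 : ℝ) < s := hp.trans_le hps
  have ht : (0 : ℝ) < t := hs.trans hst
  have ht1 : (t : ℝ) ≤ 1 := t.2.2
  set A' := A.erase f with hA'
  have hdis : Disjoint A' {e, f} := by
    rw [Finset.disjoint_left]
    intro y hy
    rw [hA', Finset.mem_erase] at hy
    simp only [Finset.mem_insert, Finset.mem_singleton, not_or]
    exact ⟨fun h => heA (h ▸ hy.2), hy.1⟩
  have hsub : ∀ B ∈ (A' \ G).powerset, G ∪ B ⊆ A' := fun B hB =>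
    Finset.union_subset hG ((Finset.mem_powerset.1 hB).trans Finset.sdiff_subset)
  have h1 := sum_measure_inter_le volume R (A' \ G).powerset
    (fun B => timeBox (O (G ∪ B)) (G ∪ B) A' {e, f} p s t)
    (fun B hB => measurableSet_timeBox (hO _) (hsub B hB) hps) (by
      intro B hB B' hB' hne
      rw [Function.onFun, Set.disjoint_left]
      intro x hx hx'
      apply hne
      have key : ∀ C ∈ (A' \ G).powerset, x ∈ timeBox (O (G ∪ C)) (G ∪ C) A' {e, f} p s t →
          ∀ y, y ∈ C ↔ y ∈ A' \ G ∧ x y < s := by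
        intro C hC hx y
        rw [Finset.mem_powerset] at hC
        refine ⟨fun hy => ⟨hC hy, hx.2.1 y (Finset.mem_union_right _ hy)⟩, fun hy => ?_⟩
        by_contra hyC
        rw [Finset.mem_sdiff] at hy
        refine absurd hy.2 (not_lt_of_ge (hx.2.2.1 y ?_).1)
        simp [hy.1, hyC]
      ext y
      rw [key B hB hx, key B' hB' hx'])
  refine le_trans ?_ h1
  set r := (Finset.univ \ (insert e A)).card with hr
  have hr' : (Finset.univ \ (A' ∪ {e, f})).card = r := by
    rw [hr]
    congr 2
    ext y
    simp only [hA', Finset.mem_union, Finset.mem_erase, Finset.mem_insert, Finset.mem_singleton]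
    by_cases hyf : y = f
    · subst hyf; simp [hf]
    · simp [hyf]; tauto
  have h2 : ∀ B ∈ (A' \ G).powerset, ENNReal.ofReal (((p : ℝ) / s) ^ 2 * s ^ G.card *
      (1 - (t : ℝ)) ^ r * ((s : ℝ) ^ B.card * ((t : ℝ) - s) ^ ((A' \ G).card - B.card))) ≤
      volume (R ∩ timeBox (O (G ∪ B)) (G ∪ B) A' {e, f} p s t) := by
    intro B hB
    rw [inter_eq_right.2 (hR (G ∪ B) Finset.subset_union_left (hsub B hB)),
      volume_timeBox (hO _) (hsub B hB) hdis hps hst.le, hr',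
      pow_card_mul_pow_card_sdiff hs (hO _)]
    refine ENNReal.ofReal_le_ofReal ?_
    rw [Finset.mem_powerset] at hB
    have hc1 : (G ∪ B).card = G.card + B.card :=
      Finset.card_union_of_disjoint (Finset.disjoint_of_subset_right hB Finset.disjoint_sdiff)
    have hc2 : (A' \ (G ∪ B)).card = (A' \ G).card - B.card := by
      rw [← Finset.card_sdiff_of_subset hB, ← Finset.sup_eq_union, ← sdiff_sdiff_left]
    have h3 := ratio_pow_le hp hps' (hcard (G ∪ B))
    have h4 : (0 : ℝ) ≤ 1 - t := by linarith
    have h5 : (0 : ℝ) ≤ t - s := by linarith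
    rw [hc1, hc2, pow_add]
    calc _ = ((p : ℝ) / s) ^ 2 * ((s : ℝ) ^ G.card * s ^ B.card) *
          ((t : ℝ) - s) ^ ((A' \ G).card - B.card) * (1 - (t : ℝ)) ^ r := by ring
      _ ≤ _ := by gcongr
  refine le_trans ?_ (Finset.sum_le_sum h2)
  rw [← ENNReal.ofReal_sum_of_nonneg, ← Finset.mul_sum, Finset.sum_pow_mul_eq_add_pow,
    add_sub_cancel]
  · refine ENNReal.ofReal_le_ofReal ?_
    have hc : A.card = G.card + (A' \ G).card + 1 := by
      rw [add_comm G.card, Finset.card_sdiff_add_card_eq_card hG, hA',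
        Finset.card_erase_add_one hf]
    have h4 : (0 : ℝ) ≤ (1 - (t : ℝ)) ^ r := pow_nonneg (by linarith) _
    have h5 : (t : ℝ) ^ A.card * (((p : ℝ) / t) ^ 2 * (s : ℝ)⁻¹) ≤
        ((p : ℝ) / s) ^ 2 * s ^ G.card * t ^ (A' \ G).card := by
      rw [hc]
      interval_cases G.card
      · have : (0 : ℝ) < (t : ℝ) ^ (A' \ G).card := by positivity
        rw [zero_add, pow_succ, div_pow, div_pow, pow_zero, mul_one]
        have h6 : (t : ℝ)⁻¹ ≤ (s : ℝ)⁻¹ := by gcongr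
        calc _ = (p : ℝ) ^ 2 * (s : ℝ)⁻¹ * t ^ (A' \ G).card * (t : ℝ)⁻¹ := by field_simp
          _ ≤ (p : ℝ) ^ 2 * (s : ℝ)⁻¹ * t ^ (A' \ G).card * (s : ℝ)⁻¹ := by gcongr
          _ = _ := by field_simp
      · apply le_of_eq
        rw [add_comm 1, pow_succ, pow_succ]
        field_simp
    rw [weight, ← hr]
    calc _ = (t : ℝ) ^ A.card * (((p : ℝ) / t) ^ 2 * (s : ℝ)⁻¹) * (1 - (t : ℝ)) ^ r := by ring
      _ ≤ ((p : ℝ) / s) ^ 2 * s ^ G.card * t ^ (A' \ G).card * (1 - (t : ℝ)) ^ r := by gcongr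
      _ = _ := by ring
  · intro B _
    have h4 : (0 : ℝ) ≤ 1 - t := by linarith
    have h5 : (0 : ℝ) ≤ t - s := by linarith
    positivity

/-- Integrating the frozen time s of `f` over [p, t) turns 1/s into the logarithm. -/
lemma weight_le_volume_single {e f : E} {A G : Finset E} (heA : e ∉ A) (hf : f ∈ A)
    (hG : G ⊆ A.erase f) (hG1 : G.card ≤ 1) {p t : I} (hp : 0 < (p : ℝ)) (hpt : p ≤ t)
    {R : Set (E → I)}
    (hR : ∀ s, p ≤ s → s < t → ∀ B, G ⊆ B → B ⊆ A.erase f →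
      ∀ x ∈ timeBox (O B) B (A.erase f) {e, f} p s t, update x f s ∈ R) :
    ENNReal.ofReal (weight e A t * (((p : ℝ) / t) ^ 2 * Real.log (t / p))) ≤ volume R := by
  have hpt' : (p : ℝ) ≤ t := hpt
  have ht : (0 : ℝ) < t := hp.trans_le hpt
  have hw := weight_nonneg e A t.2.1 t.2.2
  refine le_trans ?_ (lintegral_measure_update_le f R)
  have hint : ∫ s in (p : ℝ)..t, weight e A t * (((p : ℝ) / t) ^ 2 * s⁻¹) =
      weight e A t * (((p : ℝ) / t) ^ 2 * Real.log (t / p)) := by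
    rw [intervalIntegral.integral_const_mul, intervalIntegral.integral_const_mul,
      integral_inv_of_pos hp ht]
  rw [← hint, ← setLIntegral_unitInterval p.2.1 hpt' t.2.2]
  · refine le_trans (setLIntegral_mono_ae' ?_ (Filter.Eventually.of_forall fun s hs => ?_))
      (setLIntegral_le_lintegral (((↑) : I → ℝ) ⁻¹' Ico (p : ℝ) t) _)
    · exact measurable_subtype_coe measurableSet_Ico
    · exact weight_le_volume_of_update hO hcard heA hf hG hG1 hp hs.1 hs.2
        fun B hGB hBA x hx => hR s hs.1 hs.2 B hGB hBA x hx
  · refine continuousOn_const.mul (continuousOn_const.mul (continuousOn_inv₀.mono ?_))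
    exact fun s hs => (hp.trans_le hs.1).ne'
  · intro s hs
    have : 0 < s := hp.trans_le hs.1
    positivity

end Conditional

/-! ### Selection bounds for both algorithms, given the arrival time of the optimal element. -/

section Bounds

open unitInterval Function

variable {E : Type*} [Fintype E] [DecidableEq E]

/-- The elements arriving before time `a`. -/
noncomputable def before (x : E → I) (a : I) : Finset E := Finset.univ.filter fun y => x y < a

omit [DecidableEq E] in
@[simp]
lemma mem_before {x : E → I} {a : I} {y : E} : y ∈ before x a ↔ x y < a := by simp [before]

/-- The probability that the optimum before time `t` meets `K`, given that `e` arrives at `t`. -/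
noncomputable def meetProb (O : Finset E → Finset E) (K : Finset E) (e : E) (t : ℝ) : ℝ :=
  ∑ A ∈ (Finset.univ.erase e).powerset, if (O A ∩ K).Nonempty then weight e A t else 0

lemma meetProb_nonneg (O : Finset E → Finset E) (K : Finset E) (e : E) {t : ℝ} (h0 : 0 ≤ t)
    (h1 : t ≤ 1) : 0 ≤ meetProb O K e t := by
  refine Finset.sum_nonneg fun A _ => ?_
  split_ifs
  · exact weight_nonneg e A h0 h1
  · exact le_rfl

lemma meetProb_le_one (O : Finset E → Finset E) (K : Finset E) (e : E) {t : ℝ} (h0 : 0 ≤ t)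
    (h1 : t ≤ 1) : meetProb O K e t ≤ 1 := by
  rw [← sum_weight e t]
  refine Finset.sum_le_sum fun A _ => ?_
  split_ifs
  · exact le_rfl
  · exact weight_nonneg e A h0 h1

lemma continuous_meetProb (O : Finset E → Finset E) (K : Finset E) (e : E) :
    Continuous (meetProb O K e) := by
  refine continuous_finsetSum _ fun A _ => ?_
  split_ifs
  · unfold weight; fun_prop
  · exact continuous_const

lemma sum_weight_ite (O : Finset E → Finset E) (K : Finset E) (e : E) (t a b : ℝ) :
    ∑ A ∈ (Finset.univ.erase e).powerset, weight e A t * (if (O A ∩ K).Nonempty then a else b) =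
      meetProb O K e t * a + (1 - meetProb O K e t) * b := by
  rw [← sum_weight e t, meetProb, ← Finset.sum_sub_distrib, Finset.sum_mul, Finset.sum_mul,
    ← Finset.sum_add_distrib]
  refine Finset.sum_congr rfl fun A _ => ?_
  split_ifs <;> ring

/-- The elements other than `e` with times below `t` are those of `A`. -/
def cell (e : E) (t : I) (A : Finset E) : Set (E → I) := {x | ∀ y, y ≠ e → (x y < t ↔ y ∈ A)}

omit [Fintype E] [DecidableEq E] in
lemma measurableSet_cell [Finite E] (e : E) (t : I) (A : Finset E) :
    MeasurableSet (cell e t A) := by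
  have : cell e t A = ⋂ (y : E) (_ : y ≠ e), (fun x : E → I => x y) ⁻¹' {a | a < t ↔ y ∈ A} := by
    ext x
    simp [cell]
  rw [this]
  refine MeasurableSet.iInter fun y => MeasurableSet.iInter fun _ => measurable_pi_apply y ?_
  by_cases h : y ∈ A
  · have : {a | a < t ↔ y ∈ A} = Iio t := by ext; simp [h]
    exact this ▸ measurableSet_Iio
  · have : {a | a < t ↔ y ∈ A} = Ici t := by ext; simp [h]
    exact this ▸ measurableSet_Ici

lemma before_update {e : E} {t : I} {A : Finset E} (heA : e ∉ A) {x : E → I}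
    (hx : x ∈ cell e t A) : before (update x e t) t = A := by
  ext y
  rw [mem_before]
  by_cases h : y = e
  · subst h; simp [heA]
  · rw [update_of_ne h]; exact hx y h

omit [Fintype E] in
lemma timeBox_subset_cell {e : E} {A G : Finset E} {p t : I} :
    timeBox G A A {e} p t t ⊆ cell e t A := by
  intro x hx y hy
  refine ⟨fun h => ?_, fun h => hx.2.1 y h⟩
  by_contra hA
  exact absurd h (not_lt_of_ge (hx.2.2.2 y (by simp [hA, hy])))

lemma sum_cell_le {e : E} {t : I} (S : Set (E → I)) :
    ∑ A ∈ (Finset.univ.erase e).powerset, volume (S ∩ cell e t A) ≤ volume S := by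
  refine sum_measure_inter_le volume S _ (cell e t) (fun A _ => measurableSet_cell e t A) ?_
  intro A hA B hB hne
  rw [Function.onFun, Set.disjoint_left]
  intro x hx hx'
  apply hne
  have hA' : e ∉ A := fun h => by simpa using Finset.mem_powerset.1 hA h
  have hB' : e ∉ B := fun h => by simpa using Finset.mem_powerset.1 hB h
  rw [← before_update hA' hx, before_update hB' hx']

variable {O : Finset E → Finset E} (hO : ∀ A, O A ⊆ A) {e : E} {p : I} (hp : 0 < (p : ℝ))
  {S : Set (E → I)}
  (hS : ∀ x : E → I, p ≤ x e → (∀ y ∈ O (before x (x e)), x y < p) → x ∈ S)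

include hO hp hS

lemma weight_le_volume_sample {t : I} (hpt : p ≤ t) {A : Finset E} (heA : e ∉ A) :
    ENNReal.ofReal (weight e A t * ((p : ℝ) / t) ^ (O A).card) ≤
      volume (({x | update x e t ∈ S} ∩ cell e t A) ∩ {x | ∀ y ∈ O A, x y < p}) := by
  rw [← volume_timeBox_sample heA (hO A) hp hpt]
  refine measure_mono fun x hx => ?_
  have hcell := timeBox_subset_cell hx
  refine ⟨⟨hS _ (by simpa using hpt) ?_, hcell⟩, hx.1⟩
  rw [update_self, before_update heA hcell]
  intro y hy
  have hye : y ≠ e := fun h => heA (h ▸ hO A hy)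
  rw [update_of_ne hye]
  exact hx.1 y hy

variable {K : Finset E} (hcard : ∀ A, (O A).card ≤ 2)

include hcard

lemma oblivious_lower_bound_at
    (hS1 : ∀ (x : E → I) (g : E), p ≤ x e → g ∈ O (before x (x e)) → g ∈ K → x g < p → x ∈ S)
    {t : I} (hpt : p ≤ t) :
    ENNReal.ofReal (meetProb O K e t * ((p : ℝ) / t) + (1 - meetProb O K e t) * ((p : ℝ) / t) ^ 2) ≤
      volume {x | update x e t ∈ S} := by
  have hw : ∀ A, 0 ≤ weight e A (t : ℝ) := fun A => weight_nonneg e A t.2.1 t.2.2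
  have ht : (0 : ℝ) < t := hp.trans_le hpt
  refine le_trans ?_ (sum_cell_le (e := e) (t := t) _)
  rw [← sum_weight_ite, ENNReal.ofReal_sum_of_nonneg]
  · refine Finset.sum_le_sum fun A hA => ?_
    have heA : e ∉ A := fun h => by simpa using Finset.mem_powerset.1 hA h
    split_ifs with h
    · obtain ⟨g, hg⟩ := h
      rw [Finset.mem_inter] at hg
      have := volume_timeBox_sample heA (G := {g}) (by simpa using hO A hg.1) hp hpt
      rw [Finset.card_singleton, pow_one] at this
      rw [← this]
      refine measure_mono fun x hx => ?_
      have hcell := timeBox_subset_cell hx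
      refine ⟨hS1 _ g (by simpa using hpt) ?_ hg.2 ?_, hcell⟩
      · rw [update_self, before_update heA hcell]; exact hg.1
      · have hge : g ≠ e := fun h => heA (h ▸ hO A hg.1)
        rw [update_of_ne hge]
        exact hx.1 g (by simp)
    · refine le_trans (ENNReal.ofReal_le_ofReal ?_)
        ((weight_le_volume_sample hO hp hS hpt heA).trans (measure_mono inter_subset_left))
      exact mul_le_mul_of_nonneg_left (ratio_pow_le hp hpt (hcard A)) (hw A)
  · intro A _
    split_ifs <;> exact mul_nonneg (hw A) (by positivity)

/-- The contribution of one `f` as the last element of the optimum before t; `G` is the rest of that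
optimum, which must precede `f`. -/
lemma weight_le_volume_greedy
    (hS1 : ∀ (x : E → I) (f : E), p ≤ x e → f ∈ O (before x (x e)) → f ∉ K → p ≤ x f →
      (∀ y ∈ O (before x (x e)), y ≠ f → x y < x f) → (∀ y ∈ O (before x (x f)), x y < p) → x ∈ S)
    {t : I} (hpt : p ≤ t) {A : Finset E} (heA : e ∉ A) {f : E} (hf : f ∈ O A) (hfK : f ∉ K) :
    ENNReal.ofReal (weight e A t * (((p : ℝ) / t) ^ 2 * Real.log (t / p))) ≤
      volume (({x | update x e t ∈ S} ∩ cell e t A) ∩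
        {x | p ≤ x f ∧ ∀ y ∈ O A, y ≠ f → x y < x f}) := by
  have hfA := hO A hf
  have hfe : f ≠ e := fun h => heA (h ▸ hfA)
  refine weight_le_volume_single hO hcard heA hfA (G := (O A).erase f)
    (Finset.erase_subset_erase _ (hO A)) ?_ hp hpt ?_
  · have := hcard A
    rw [Finset.card_erase_of_mem hf]
    omega
  · intro s hps hst B hGB hBA x hx
    have hcell : update x f s ∈ cell e t A := by
      intro y hy
      by_cases hyf : y = f
      · subst hyf; simp [hst, hfA]
      · rw [update_of_ne hyf]
        constructor
        · intro h
          by_contra hyA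
          exact absurd h (not_lt_of_ge (hx.2.2.2 y (by simp [hyA, hy, hyf])))
        · intro h
          by_cases hyB : y ∈ B
          · exact (hx.2.1 y hyB).trans hst
          · exact (hx.2.2.1 y (by simp [h, hyB, hyf])).2
    have hfirst : ∀ y ∈ O A, y ≠ f → update x f s y < update x f s f := by
      intro y hy hyf
      rw [update_self, update_of_ne hyf]
      exact hx.2.1 y (hGB (Finset.mem_erase.2 ⟨hyf, hy⟩))
    have hB : before (update (update x f s) e t) s = B := by
      ext y
      rw [mem_before]
      by_cases hye : y = e
      · subst hye
        rw [update_self]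
        exact ⟨fun h => absurd h hst.not_gt,
          fun h => absurd (Finset.mem_of_mem_erase (hBA h)) heA⟩
      rw [update_of_ne hye]
      by_cases hyf : y = f
      · subst hyf
        rw [update_self]
        exact ⟨fun h => absurd h (lt_irrefl _),
          fun h => absurd rfl (Finset.ne_of_mem_erase (hBA h))⟩
      rw [update_of_ne hyf]
      refine ⟨fun h => ?_, fun h => hx.2.1 y h⟩
      by_contra hyB
      by_cases hyA : y ∈ A
      · exact absurd h (not_lt_of_ge (hx.2.2.1 y (by simp [hyA, hyB, hyf])).1)
      · exact absurd (h.trans hst) (not_lt_of_ge (hx.2.2.2 y (by simp [hyA, hye, hyf])))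
    refine ⟨⟨?_, hcell⟩, by simpa using hps, hfirst⟩
    refine hS1 _ f (by simpa using hpt) ?_ hfK ?_ ?_ ?_
    · rwa [update_self, before_update heA hcell]
    · rw [update_of_ne hfe, update_self]; exact hps
    · rw [update_self, before_update heA hcell]
      intro y hy hyf
      have hye : y ≠ e := fun h => heA (h ▸ hO A hy)
      rw [update_of_ne hye, update_of_ne hfe]
      exact hfirst y hy hyf
    · rw [update_of_ne hfe, update_self, hB]
      intro y hy
      have hyB := hO B hy
      have hye : y ≠ e := fun h => heA (h ▸ Finset.mem_of_mem_erase (hBA hyB))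
      rw [update_of_ne hye, update_of_ne (Finset.ne_of_mem_erase (hBA hyB))]
      exact hx.1 y hy

omit hO hp hS hcard in
-- An optimum with o < 2 elements offers fewer choices of f, but its chance of being fully sampled
-- rises to u^(-o). The inequalities 1 + log u ≤ u and 1 + 2 log u ≤ u^2 show that this pays for the
-- 2 - o missing terms.
lemma ratio_bound {u : ℝ} (hu : 1 ≤ u) {o k m : ℕ} (ho : o ≤ 2) (hm : m ≤ k + (2 - o)) :
    (1 / u) ^ 2 * (1 + m * Real.log u) ≤ (1 / u) ^ o + k * ((1 / u) ^ 2 * Real.log u) := by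
  have hu0 : 0 < u := by linarith
  have hlog : 0 ≤ Real.log u := Real.log_nonneg hu
  have hlog1 : Real.log u ≤ u - 1 := Real.log_le_sub_one_of_pos hu0
  have hm' : (m : ℝ) ≤ k + (2 - o : ℕ) := by exact_mod_cast hm
  have hv : 0 ≤ (1 / u) ^ 2 := by positivity
  have h1 : (1 / u) ^ 2 * (1 + (2 - o : ℕ) * Real.log u) ≤ (1 / u) ^ o := by
    rw [one_div, inv_pow, inv_pow, inv_mul_le_iff₀ (by positivity)]
    interval_cases o
    · norm_num
      have h2 : Real.log (u ^ 2) ≤ u ^ 2 - 1 := Real.log_le_sub_one_of_pos (by positivity)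
      rw [Real.log_pow] at h2
      push_cast at h2
      linarith
    · norm_num
      field_simp
      nlinarith
    · norm_num
      rw [mul_inv_cancel₀ (by positivity)]
  nlinarith [mul_le_mul_of_nonneg_right hm' hlog, mul_le_mul_of_nonneg_left
    (mul_le_mul_of_nonneg_right hm' hlog) hv]

lemma greedy_lower_bound_at (hK : ∀ A, (O A ∩ K).card ≤ 1)
    (hS1 : ∀ (x : E → I) (f : E), p ≤ x e → f ∈ O (before x (x e)) → f ∉ K → p ≤ x f →
      (∀ y ∈ O (before x (x e)), y ≠ f → x y < x f) → (∀ y ∈ O (before x (x f)), x y < p) → x ∈ S)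
    {t : I} (hpt : p ≤ t) :
    ENNReal.ofReal (((p : ℝ) / t) ^ 2 * (1 + (2 - meetProb O K e t) * Real.log (t / p))) ≤
      volume {x | update x e t ∈ S} := by
  have hw : ∀ A, 0 ≤ weight e A (t : ℝ) := fun A => weight_nonneg e A t.2.1 t.2.2
  have ht : (0 : ℝ) < t := hp.trans_le hpt
  have hpt' : (p : ℝ) ≤ t := hpt
  have hu : 1 ≤ (t : ℝ) / p := (one_le_div hp).2 hpt'
  have hlog : 0 ≤ Real.log ((t : ℝ) / p) := Real.log_nonneg hu
  have hinv : (p : ℝ) / t = 1 / (t / p) := by rw [one_div_div]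
  refine le_trans ?_ (sum_cell_le (e := e) (t := t) _)
  have heq : ((p : ℝ) / t) ^ 2 * (1 + (2 - meetProb O K e t) * Real.log (t / p)) =
      ∑ A ∈ (Finset.univ.erase e).powerset, weight e A t * (if (O A ∩ K).Nonempty then
        ((p : ℝ) / t) ^ 2 * (1 + (1 : ℕ) * Real.log (t / p)) else
        ((p : ℝ) / t) ^ 2 * (1 + (2 : ℕ) * Real.log (t / p))) := by
    rw [sum_weight_ite]
    push_cast
    ring
  rw [heq, ENNReal.ofReal_sum_of_nonneg]
  · refine Finset.sum_le_sum fun A hA => ?_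
    have heA : e ∉ A := fun h => by simpa using Finset.mem_powerset.1 hA h
    set R := {x | update x e t ∈ S} ∩ cell e t A with hR
    -- Disjoint reasons for success: `none` means that the whole optimum is sampled, `some f` that
    -- its last element is `f`, at or after p.
    let D : Option E → Set (E → I) := fun o => o.elim {x | ∀ y ∈ O A, x y < p}
      (fun f => {x | p ≤ x f ∧ ∀ y ∈ O A, y ≠ f → x y < x f})
    have hDm : ∀ o, MeasurableSet (D o) := by
      have hset : ∀ f : E, MeasurableSet (⋂ (y) (_ : y ∈ O A) (_ : y ≠ f), {x : E → I | x y < x f}) :=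
        fun f => MeasurableSet.iInter fun y => MeasurableSet.iInter fun _ =>
          MeasurableSet.iInter fun _ =>
            measurableSet_lt (measurable_pi_apply y) (measurable_pi_apply f)
      rintro (_ | f)
      · have : D none = ⋂ (y) (_ : y ∈ O A), {x : E → I | x y < p} := by
          ext x; simp [D]
        rw [this]
        exact MeasurableSet.iInter fun y => MeasurableSet.iInter fun _ =>
          measurableSet_lt (measurable_pi_apply y) measurable_const
      · have : D (some f) = {x : E → I | p ≤ x f} ∩
            ⋂ (y) (_ : y ∈ O A) (_ : y ≠ f), {x : E → I | x y < x f} := by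
          ext x; simp [D]
        rw [this]
        exact (measurableSet_le measurable_const (measurable_pi_apply f)).inter (hset f)
    have hdisj : ((Finset.insertNone (O A \ K) : Finset (Option E)) :
        Set (Option E)).PairwiseDisjoint D := by
      intro a ha b hb hab
      rw [Function.onFun, Set.disjoint_left]
      intro x hx hx'
      rcases a with _ | f <;> rcases b with _ | g
      · exact hab rfl
      · have hg : g ∈ O A := by simp at hb; exact hb.1
        exact absurd (hx g hg) (not_lt_of_ge hx'.1)
      · have hf : f ∈ O A := by simp at ha; exact ha.1
        exact absurd (hx' f hf) (not_lt_of_ge hx.1)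
      · have hf : f ∈ O A := by simp at ha; exact ha.1
        have hg : g ∈ O A := by simp at hb; exact hb.1
        have hne : f ≠ g := fun h => hab (by rw [h])
        exact absurd (hx.2 g hg hne.symm) (hx'.2 f hf hne).not_gt
    refine le_trans ?_ (sum_measure_inter_le volume R (Finset.insertNone (O A \ K)) D
      (fun o _ => hDm o) hdisj)
    rw [Finset.sum_insertNone]
    refine le_trans ?_ (add_le_add (weight_le_volume_sample hO hp hS hpt heA)
      (Finset.sum_le_sum fun f hf => weight_le_volume_greedy hO hp hS hcard hS1 hpt heA
        (Finset.mem_sdiff.1 hf).1 (Finset.mem_sdiff.1 hf).2))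
    have hnn : 0 ≤ ((p : ℝ) / t) ^ 2 * Real.log (t / p) := mul_nonneg (by positivity) hlog
    rw [Finset.sum_const, ← ENNReal.ofReal_nsmul, ← ENNReal.ofReal_add
      (mul_nonneg (hw A) (by positivity)) (nsmul_nonneg (mul_nonneg (hw A) hnn) _), nsmul_eq_mul]
    refine ENNReal.ofReal_le_ofReal ?_
    have hco := Finset.card_sdiff_add_card_inter (O A) K
    have hcA := hcard A
    have hKA := hK A
    have hgoal : ∀ m : ℕ, m ≤ (O A \ K).card + (2 - (O A).card) →
        weight e A t * (((p : ℝ) / t) ^ 2 * (1 + m * Real.log (t / p))) ≤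
        weight e A t * ((p : ℝ) / t) ^ (O A).card + ((O A \ K).card : ℝ) *
          (weight e A t * (((p : ℝ) / t) ^ 2 * Real.log (t / p))) := by
      intro m hm
      have := mul_le_mul_of_nonneg_left (ratio_bound hu hcA hm) (hw A)
      rw [← hinv] at this
      linarith
    split_ifs with h
    · exact hgoal 1 (by omega)
    · have : (O A ∩ K).card = 0 := by
        rw [Finset.card_eq_zero]; exact Finset.not_nonempty_iff_eq_empty.1 h
      exact hgoal 2 (by omega)
  · intro A _
    split_ifs <;> exact mul_nonneg (hw A) (mul_nonneg (by positivity) (by positivity))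

end Bounds

/-! ### Logarithm estimates and the integral of the mixture bound. -/

section Numerics

/-- The series of 2 artanh x with x = (u-1)/(u+1), truncated after n terms. -/
lemma log_mem_Icc_of_eq {x u : ℝ} (h0 : 0 ≤ x) (h1 : x < 1) (hu : u = (1 + x) / (1 - x)) (n : ℕ) :
    2 * ∑ i ∈ Finset.range n, x ^ (2 * i + 1) / (2 * i + 1) ≤ Real.log u ∧
      Real.log u ≤ 2 * (∑ i ∈ Finset.range n, x ^ (2 * i + 1) / (2 * i + 1) +
        x ^ (2 * n + 1) / (1 - x ^ 2)) := by
  rw [hu]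
  have h2 := Real.sum_range_le_log_div h0 h1 n
  have h3 := Real.log_div_le_sum_range_add h0 h1 n
  constructor <;> linarith

lemma log_crossing : 0.815364 ≤ Real.log 2.26 ∧ Real.log 2.26 ≤ 0.815366 := by
  have h := log_mem_Icc_of_eq (x := 63 / 163) (u := 2.26) (by norm_num) (by norm_num)
    (by norm_num) 8
  constructor
  · refine le_trans ?_ h.1
    norm_num [Finset.sum_range_succ]
  · refine h.2.trans ?_
    norm_num [Finset.sum_range_succ]

lemma log_inv_sample_le : Real.log (1 / 0.4067) ≤ 0.89968 := by
  have h := log_mem_Icc_of_eq (x := 5933 / 14067) (u := 1 / 0.4067) (by norm_num) (by norm_num)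
    (by norm_num) 9
  refine h.2.trans ?_
  norm_num [Finset.sum_range_succ]

lemma log_ge_of_le {u v : ℝ} (hu : 1 ≤ u) (huv : u ≤ v) (hv : 1 < v) :
    (u - 1) / (v - 1) * Real.log v ≤ Real.log u := by
  have hcv := strictConcaveOn_log_Ioi.concaveOn
  have h := hcv.2 (show (1 : ℝ) ∈ Ioi 0 by simp) (show v ∈ Ioi 0 from by simp; linarith)
    (show 0 ≤ (v - u) / (v - 1) from div_nonneg (by linarith) (by linarith))
    (show 0 ≤ (u - 1) / (v - 1) from div_nonneg (by linarith) (by linarith))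
    (by rw [← add_div, div_eq_one_iff_eq (by linarith)]; ring)
  have hv' : v - 1 ≠ 0 := by linarith
  simp only [smul_eq_mul, Real.log_one, mul_zero, zero_add, mul_one] at h
  have : (v - u) / (v - 1) + (u - 1) / (v - 1) * v = u := by field_simp; ring
  rwa [this] at h

/-- By concavity log lies above its chord from 1 to 2.26, which reduces the claim to the endpoint.
-/
lemma crossing_le {u : ℝ} (hu : 1 ≤ u) (huv : u ≤ 2.26) :
    0.3928 * (u - 1) - 0.6072 * Real.log u ≤ 0 := by
  have h1 := log_ge_of_le hu huv (by norm_num)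
  have h2 := log_crossing.1
  have h3 : (u - 1) / (2.26 - 1) * 0.815364 ≤ (u - 1) / (2.26 - 1) * Real.log 2.26 :=
    mul_le_mul_of_nonneg_left h2 (div_nonneg (by linarith) (by norm_num))
  norm_num at h1 h3 ⊢
  linarith

/-- The true crossing is slightly beyond 2.26, hence the small negative slack; the tangent of log at
2.26 handles larger u. -/
lemma le_crossing {u : ℝ} (huv : 2.26 ≤ u) :
    -0.000164 ≤ 0.3928 * (u - 1) - 0.6072 * Real.log u := by
  have h2 := log_crossing.2
  have h1 : Real.log u = Real.log 2.26 + Real.log (u / 2.26) := by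
    rw [← Real.log_mul (by norm_num) (by positivity)]
    congr 1
    field_simp
  have h3 := Real.log_le_sub_one_of_pos (show (0 : ℝ) < u / 2.26 by positivity)
  rw [h1]
  norm_num at h2 h3 ⊢
  linarith

/-- The mixture bound when the optimum before time `t` always meets the class of `e`. -/
noncomputable def meetBound (t : ℝ) : ℝ :=
  0.6072 * ((0.4067 / t) ^ 2 * (1 + Real.log (t / 0.4067))) + 0.3928 * (0.4067 / t)

/-- The mixture bound when the optimum before time `t` never meets the class of `e`. -/
noncomputable def avoidBound (t : ℝ) : ℝ :=
  0.6072 * ((0.4067 / t) ^ 2 * (1 + 2 * Real.log (t / 0.4067))) + 0.3928 * (0.4067 / t) ^ 2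

lemma hasDerivAt_log_div {t : ℝ} (ht : 0 < t) :
    HasDerivAt (fun t : ℝ => Real.log (t / 0.4067)) (1 / t) t := by
  refine (((hasDerivAt_id' t).div_const 0.4067).log (by positivity)).congr_deriv ?_
  field_simp

lemma hasDerivAt_ratio_log {t : ℝ} (ht : 0 < t) (c k : ℝ) :
    HasDerivAt (fun t : ℝ => -0.4067 ^ 2 * t⁻¹ * (c + k + k * Real.log (t / 0.4067)))
      ((0.4067 / t) ^ 2 * (c + k * Real.log (t / 0.4067))) t := by
  have h1 := (hasDerivAt_inv ht.ne').const_mul (-0.4067 ^ 2)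
  have h2 := ((hasDerivAt_log_div ht).const_mul k).const_add (c + k)
  refine (h1.mul h2).congr_deriv ?_
  field_simp
  ring

lemma continuousOn_ratio : ContinuousOn (fun t : ℝ => 0.4067 / t) (Ioi 0) :=
  continuousOn_const.div continuousOn_id fun _ ht => ne_of_gt ht

lemma continuousOn_log_ratio : ContinuousOn (fun t : ℝ => Real.log (t / 0.4067)) (Ioi 0) :=
  fun _ ht => (hasDerivAt_log_div ht).continuousAt.continuousWithinAt

lemma continuousOn_meetBound : ContinuousOn meetBound (Ioi 0) := by
  unfold meetBound
  exact ((continuousOn_const.mul ((continuousOn_ratio.pow 2).mul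
    (continuousOn_const.add continuousOn_log_ratio))).add (continuousOn_const.mul
      continuousOn_ratio))

lemma continuousOn_avoidBound : ContinuousOn avoidBound (Ioi 0) := by
  unfold avoidBound
  exact ((continuousOn_const.mul ((continuousOn_ratio.pow 2).mul
    (continuousOn_const.add (continuousOn_const.mul continuousOn_log_ratio)))).add
      (continuousOn_const.mul (continuousOn_ratio.pow 2)))

lemma uIcc_subset_Ioi {a b : ℝ} (ha : 0 < a) (hb : 0 < b) : uIcc a b ⊆ Ioi 0 :=
  fun _ ht => lt_of_lt_of_le (lt_min ha hb) ht.1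

lemma integral_meetBound {a b : ℝ} (ha : 0 < a) (hb : 0 < b) :
    ∫ t in a..b, meetBound t =
      (0.6072 * (-0.4067 ^ 2 * b⁻¹ * (1 + 1 + 1 * Real.log (b / 0.4067))) +
        0.3928 * (0.4067 * Real.log (b / 0.4067))) -
      (0.6072 * (-0.4067 ^ 2 * a⁻¹ * (1 + 1 + 1 * Real.log (a / 0.4067))) +
        0.3928 * (0.4067 * Real.log (a / 0.4067))) := by
  refine intervalIntegral.integral_eq_sub_of_hasDerivAt (f := fun t =>
    0.6072 * (-0.4067 ^ 2 * t⁻¹ * (1 + 1 + 1 * Real.log (t / 0.4067))) +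
        0.3928 * (0.4067 * Real.log (t / 0.4067))) (fun t ht => ?_)
    (continuousOn_meetBound.mono (uIcc_subset_Ioi ha hb)).intervalIntegrable
  have ht0 : 0 < t := uIcc_subset_Ioi ha hb ht
  have h := ((hasDerivAt_ratio_log ht0 1 1).const_mul 0.6072).add
    (((hasDerivAt_log_div ht0).const_mul 0.4067).const_mul 0.3928)
  refine h.congr_deriv ?_
  rw [meetBound]
  ring

lemma integral_avoidBound {a b : ℝ} (ha : 0 < a) (hb : 0 < b) (δ : ℝ) :
    ∫ t in a..b, (avoidBound t - δ * (0.4067 / t) ^ 2) =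
      (0.6072 * (-0.4067 ^ 2 * b⁻¹ * (1 + 2 + 2 * Real.log (b / 0.4067))) +
        (0.3928 - δ) * (-0.4067 ^ 2 * b⁻¹ * (1 + 0 + 0 * Real.log (b / 0.4067)))) -
      (0.6072 * (-0.4067 ^ 2 * a⁻¹ * (1 + 2 + 2 * Real.log (a / 0.4067))) +
        (0.3928 - δ) * (-0.4067 ^ 2 * a⁻¹ * (1 + 0 + 0 * Real.log (a / 0.4067)))) := by
  refine intervalIntegral.integral_eq_sub_of_hasDerivAt (f := fun t =>
    0.6072 * (-0.4067 ^ 2 * t⁻¹ * (1 + 2 + 2 * Real.log (t / 0.4067))) +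
        (0.3928 - δ) * (-0.4067 ^ 2 * t⁻¹ * (1 + 0 + 0 * Real.log (t / 0.4067)))) (fun t ht => ?_)
    ((continuousOn_avoidBound.sub (continuousOn_const.mul (continuousOn_ratio.pow 2))).mono
      (uIcc_subset_Ioi ha hb)).intervalIntegrable
  have ht0 : 0 < t := uIcc_subset_Ioi ha hb ht
  have h := ((hasDerivAt_ratio_log ht0 1 2).const_mul 0.6072).add
    ((hasDerivAt_ratio_log ht0 1 0).const_mul (0.3928 - δ))
  refine h.congr_deriv ?_
  rw [avoidBound]
  ring

lemma meetBound_sub_avoidBound {t : ℝ} (ht : 0 < t) :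
    meetBound t - avoidBound t = (0.4067 / t) ^ 2 *
      (0.3928 * (t / 0.4067 - 1) - 0.6072 * Real.log (t / 0.4067)) := by
  rw [meetBound, avoidBound]
  have : 0.4067 / t = (0.4067 / t) ^ 2 * (t / 0.4067) := by field_simp
  nth_rw 2 [this]
  ring

lemma mixture_integral_bound {φ : ℝ → ℝ} (hφ : Continuous φ)
    (hφ0 : ∀ t ∈ Icc (0.4067 : ℝ) 1, 0 ≤ φ t) (hφ1 : ∀ t ∈ Icc (0.4067 : ℝ) 1, φ t ≤ 1) :
    0.3462 ≤ ∫ t in (0.4067 : ℝ)..1, (φ t * meetBound t + (1 - φ t) * avoidBound t) := by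
  have hc : ContinuousOn (fun t => φ t * meetBound t + (1 - φ t) * avoidBound t) (Ioi 0) :=
    (hφ.continuousOn.mul continuousOn_meetBound).add
      ((continuousOn_const.sub hφ.continuousOn).mul continuousOn_avoidBound)
  have hi : ∀ a b : ℝ, 0 < a → 0 < b → IntervalIntegrable
      (fun t => φ t * meetBound t + (1 - φ t) * avoidBound t) volume a b := fun a b ha hb =>
    (hc.mono (uIcc_subset_Ioi ha hb)).intervalIntegrable
  -- The split point is 2.26 · 0.4067, the approximate crossing of the two bounds.
  rw [← intervalIntegral.integral_add_adjacent_intervals (b := 0.919142)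
    (hi _ _ (by norm_num) (by norm_num)) (hi _ _ (by norm_num) (by norm_num))]
  have h1 : ∫ t in (0.4067 : ℝ)..0.919142, meetBound t ≤
      ∫ t in (0.4067 : ℝ)..0.919142, (φ t * meetBound t + (1 - φ t) * avoidBound t) := by
    refine intervalIntegral.integral_mono_on (by norm_num)
      (continuousOn_meetBound.mono (uIcc_subset_Ioi (by norm_num)
        (by norm_num))).intervalIntegrable (hi _ _ (by norm_num) (by norm_num)) fun t ht => ?_
    have ht0 : 0 < t := lt_of_lt_of_le (by norm_num) ht.1
    have hu : t / 0.4067 ≤ 2.26 := by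
      rw [div_le_iff₀ (by norm_num)]; have := ht.2; norm_num at this ⊢; linarith
    have hu1 : 1 ≤ t / 0.4067 := (one_le_div (by norm_num)).2 ht.1
    have hle : meetBound t - avoidBound t ≤ 0 := by
      rw [meetBound_sub_avoidBound ht0]
      exact mul_nonpos_of_nonneg_of_nonpos (by positivity) (crossing_le hu1 hu)
    have hmem : t ∈ Icc (0.4067 : ℝ) 1 := ⟨ht.1, ht.2.trans (by norm_num)⟩
    nlinarith [hφ1 t hmem]
  have h2 : ∫ t in (0.919142 : ℝ)..1, (avoidBound t - 0.000164 * (0.4067 / t) ^ 2) ≤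
      ∫ t in (0.919142 : ℝ)..1, (φ t * meetBound t + (1 - φ t) * avoidBound t) := by
    refine intervalIntegral.integral_mono_on (by norm_num)
      ((continuousOn_avoidBound.sub (continuousOn_const.mul (continuousOn_ratio.pow 2))).mono
        (uIcc_subset_Ioi (by norm_num) (by norm_num))).intervalIntegrable
        (hi _ _ (by norm_num) (by norm_num)) fun t ht => ?_
    have ht0 : 0 < t := lt_of_lt_of_le (by norm_num) ht.1
    have hu : 2.26 ≤ t / 0.4067 := by
      rw [le_div_iff₀ (by norm_num)]; have := ht.1; norm_num at this ⊢; linarith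
    have hle : -(0.000164 * (0.4067 / t) ^ 2) ≤ meetBound t - avoidBound t := by
      rw [meetBound_sub_avoidBound ht0]
      have := mul_le_mul_of_nonneg_left (le_crossing hu) (sq_nonneg (0.4067 / t))
      linarith
    have hmem : t ∈ Icc (0.4067 : ℝ) 1 := ⟨le_trans (by norm_num) ht.1, ht.2⟩
    have hsq : 0 ≤ 0.000164 * (0.4067 / t) ^ 2 := by positivity
    nlinarith [hφ0 t hmem, hφ1 t hmem]
  rw [integral_meetBound (by norm_num) (by norm_num)] at h1
  rw [integral_avoidBound (by norm_num) (by norm_num)] at h2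
  have h3 : (0.919142 : ℝ) / 0.4067 = 2.26 := by norm_num
  have h4 : (0.4067 : ℝ) / 0.4067 = 1 := by norm_num
  rw [h3, h4, Real.log_one] at h1
  rw [h3] at h2
  have h5 := log_crossing.1
  have h6 := log_inv_sample_le
  generalize Real.log 2.26 = l at *
  generalize Real.log (1 / 0.4067) = l' at *
  norm_num at h1 h2 h5 h6 ⊢
  linarith

end Numerics

/-! ### The mixture is a measurable, online algorithm with independent output. -/

section Algorithm

variable {E : Type*} [Fintype E] {M : Matroid E} {p : ℝ}

lemma measurableSet_sort_eq {n : ℕ} (π : Equiv.Perm (Fin n)) :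
    MeasurableSet {τ : Fin n → unitInterval | Tuple.sort τ = π} := by
  have : {τ : Fin n → unitInterval | Tuple.sort τ = π} =
      (⋂ (i) (j) (_ : i ≤ j), {τ : Fin n → unitInterval | τ (π i) ≤ τ (π j)}) ∩
        ⋂ (i) (j) (_ : i < j) (_ : ¬ π i < π j),
          {τ : Fin n → unitInterval | τ (π i) = τ (π j)}ᶜ := by
    ext τ
    -- Sorting breaks ties by index, so the event consists of finitely many comparisons and
    -- equalities of coordinates.
    rw [mem_ofPred_eq, eq_comm, Tuple.eq_sort_iff]
    simp only [mem_inter_iff, mem_iInter, mem_ofPred_eq, mem_compl_iff]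
    refine and_congr ⟨fun h i j hij => h hij, fun h i j hij => h i j hij⟩ ?_
    refine forall_congr' fun i => forall_congr' fun j => forall_congr' fun _ => ?_
    tauto
  rw [this]
  refine MeasurableSet.inter ?_ ?_
  · exact MeasurableSet.iInter fun i => MeasurableSet.iInter fun j => MeasurableSet.iInter fun _ =>
      measurableSet_le (measurable_pi_apply _) (measurable_pi_apply _)
  · exact MeasurableSet.iInter fun i => MeasurableSet.iInter fun j => MeasurableSet.iInter fun _ =>
      MeasurableSet.iInter fun _ =>
      (measurableSet_eq_fun (measurable_pi_apply (π i)) (measurable_pi_apply (π j))).compl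

lemma measurableSet_arrivalTime_lt (p : ℝ) (i : Fin (Fintype.card E)) :
    MeasurableSet {τ : Fin (Fintype.card E) → unitInterval | (τ (Tuple.sort τ i) : ℝ) < p} := by
  have : {τ : Fin (Fintype.card E) → unitInterval | (τ (Tuple.sort τ i) : ℝ) < p} =
      ⋃ π : Equiv.Perm (Fin (Fintype.card E)), 
        {τ | Tuple.sort τ = π} ∩ {τ : Fin (Fintype.card E) → unitInterval | (τ (π i) : ℝ) < p} := by
    ext τ
    simp
  rw [this]
  refine MeasurableSet.iUnion fun π => (measurableSet_sort_eq π).inter ?_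
  exact measurableSet_lt (measurable_subtype_coe.comp (measurable_pi_apply _)) measurable_const

/-- A set of times is measurable if membership only depends on which positions fall before `p`. -/
lemma measurableSet_of_sampled {T : Set (Fin (Fintype.card E) → unitInterval)}
    (hT : ∀ τ τ', (∀ i, ((τ (Tuple.sort τ i) : ℝ) < p ↔ (τ' (Tuple.sort τ' i) : ℝ) < p)) →
      (τ ∈ T ↔ τ' ∈ T)) : MeasurableSet T := by
  let F : (Fin (Fintype.card E) → unitInterval) → (Fin (Fintype.card E) → Prop) :=
    fun τ i => (τ (Tuple.sort τ i) : ℝ) < p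
  have hF : Measurable F := measurable_pi_iff.2 fun i =>
    measurableSet_setOfPred.1 (measurableSet_arrivalTime_lt p i)
  have : T = F ⁻¹' (F '' T) := by
    ext τ
    constructor
    · exact fun h => ⟨τ, h, rfl⟩
    · rintro ⟨τ', h', heq⟩
      exact (hT τ' τ fun i => iff_of_eq (congrFun heq i)).1 h'
  rw [this]
  exact hF (Set.toFinite _).measurableSet

variable {L : LinearOrder E} {σ : Arrival E} {τ τ' : Fin (Fintype.card E) → unitInterval}

lemma sample_congr
    (h : ∀ i, ((τ (Tuple.sort τ i) : ℝ) < p ↔ (τ' (Tuple.sort τ' i) : ℝ) < p)) :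
    sample p τ σ = sample p τ' σ := by
  ext y
  exact h (σ.symm y)

lemma candidates_eq : candidates M p τ L σ = {e | e ∉ sample p τ σ ∧ IsImproving M L σ e} := by
  ext e
  simp only [candidates, sample, mem_ofPred_eq, not_lt]

lemma candidates_congr
    (h : ∀ i, ((τ (Tuple.sort τ i) : ℝ) < p ↔ (τ' (Tuple.sort τ' i) : ℝ) < p)) :
    candidates M p τ L σ = candidates M p τ' L σ := by
  rw [candidates_eq, candidates_eq, sample_congr h]

lemma greedySet_congr
    (h : ∀ i, ((τ (Tuple.sort τ i) : ℝ) < p ↔ (τ' (Tuple.sort τ' i) : ℝ) < p)) (k : ℕ) :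
    greedySet M p τ L σ k = greedySet M p τ' L σ k := by
  induction k with
  | zero => rfl
  | succ k ih => rw [greedySet, greedySet, ih, candidates_congr h]

lemma obliviousPartition_congr
    (h : ∀ i, ((τ (Tuple.sort τ i) : ℝ) < p ↔ (τ' (Tuple.sort τ' i) : ℝ) < p)) :
    obliviousPartition M p τ L σ = obliviousPartition M p τ' L σ := by
  have hc : firstClass M p τ L σ = firstClass M p τ' L σ := by
    rw [firstClass, firstClass, sample_congr h]
  rw [obliviousPartition, obliviousPartition, candidates_congr h, hc]

lemma measurableSet_mem_greedyImproving (L : LinearOrder E) (σ : Arrival E) (e : E) :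
    MeasurableSet {τ | e ∈ greedyImproving M p τ L σ} := by
  refine measurableSet_of_sampled (p := p) fun τ τ' h => ?_
  simp only [mem_ofPred_eq, greedyImproving]
  rw [greedySet_congr h]

lemma measurableSet_mem_obliviousPartition (L : LinearOrder E) (σ : Arrival E) (e : E) :
    MeasurableSet {τ | e ∈ obliviousPartition M p τ L σ} := by
  refine measurableSet_of_sampled (p := p) fun τ τ' h => ?_
  simp only [mem_ofPred_eq]
  rw [obliviousPartition_congr h]

lemma setOf_mem_output_mixture (M : Matroid E) (p ε : ℝ) (L : LinearOrder E) (σ : Arrival E)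
    (e : E) :
    {ω | e ∈ (mixture M p ε).output ω L σ} =
      ({u : unitInterval | (u : ℝ) < ε} ×ˢ {τ | e ∈ obliviousPartition M p τ L σ}) ∪
      ({u : unitInterval | (u : ℝ) < ε}ᶜ ×ˢ {τ | e ∈ greedyImproving M p τ L σ}) := by
  ext ⟨u, τ⟩
  change (e ∈ if (u : ℝ) < ε then obliviousPartition M p τ L σ else greedyImproving M p τ L σ) ↔
    ((u : ℝ) < ε ∧ e ∈ obliviousPartition M p τ L σ) ∨
      (¬ (u : ℝ) < ε ∧ e ∈ greedyImproving M p τ L σ)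
  by_cases h : (u : ℝ) < ε
  · rw [if_pos h]
    exact ⟨fun h' => Or.inl ⟨h, h'⟩, fun h' => h'.elim And.right fun h'' => absurd h h''.1⟩
  · rw [if_neg h]
    exact ⟨fun h' => Or.inr ⟨h, h'⟩, fun h' => h'.elim (fun h'' => absurd h''.1 h) And.right⟩

lemma measurableSet_coe_lt (ε : ℝ) : MeasurableSet {u : unitInterval | (u : ℝ) < ε} :=
  measurableSet_lt measurable_subtype_coe measurable_const

section Online

variable {L' : LinearOrder E} {σ' : Arrival E} {i : Fin (Fintype.card E)}
  (hσ : ∀ j ≤ i, σ j = σ' j)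

include hσ

lemma arrivedUpTo_congr {j : Fin (Fintype.card E)} (hj : j ≤ i) :
    arrivedUpTo σ (σ j) = arrivedUpTo σ' (σ j) := by
  ext y
  have h1 : σ'.symm (σ j) = j := by rw [hσ j hj]; simp
  simp only [arrivedUpTo, mem_ofPred_eq, h1, Equiv.symm_apply_apply]
  constructor
  · intro h
    have := hσ _ (h.trans hj)
    rw [Equiv.apply_symm_apply] at this
    conv_lhs => rw [this]
    simpa using h
  · intro h
    have := hσ _ (h.trans hj)
    rw [Equiv.apply_symm_apply] at this
    conv_lhs => rw [← this]
    simpa using h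

lemma mem_sample_congr {j : Fin (Fintype.card E)} (hj : j ≤ i) :
    σ j ∈ sample p τ σ ↔ σ j ∈ sample p τ σ' := by
  have h1 : σ'.symm (σ j) = j := by rw [hσ j hj]; simp
  simp [sample, arrivalTime, h1]

variable (hL : ∀ j ≤ i, ∀ k ≤ i, (L.lt (σ j) (σ k) ↔ L'.lt (σ j) (σ k))) (hE : M.E = univ)

include hL hE

lemma mem_candidates_congr {j : Fin (Fintype.card E)} (hj : j ≤ i) :
    σ j ∈ candidates M p τ L σ ↔ σ j ∈ candidates M p τ L' σ' := by
  have h : opt M L (arrivedUpTo σ (σ j)) = opt M L' (arrivedUpTo σ (σ j)) := by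
    refine opt_congr hE fun a ha b hb => ?_
    simp only [arrivedUpTo, mem_ofPred_eq, Equiv.symm_apply_apply] at ha hb
    simpa using hL _ (ha.trans hj) _ (hb.trans hj)
  simp only [candidates_eq, mem_ofPred_eq, IsImproving]
  rw [mem_sample_congr hσ hj, h, arrivedUpTo_congr hσ hj]

lemma greedySet_online {k : ℕ} (hk : k ≤ i + 1) :
    greedySet M p τ L σ k = greedySet M p τ L' σ' k := by
  induction k with
  | zero => rfl
  | succ k ih =>
    rw [greedySet, greedySet, ih (by omega)]
    by_cases h : k < Fintype.card E
    · have hki : (⟨k, h⟩ : Fin (Fintype.card E)) ≤ i := by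
        rw [Fin.le_def]; simp; omega
      have h1 := mem_candidates_congr (p := p) (τ := τ) hσ hL hE hki
      simp only [h, dite_true]
      rw [h1, hσ _ hki]
    · simp [h]

lemma mem_greedyImproving_online :
    σ i ∈ greedyImproving M p τ L σ ↔ σ i ∈ greedyImproving M p τ L' σ' := by
  have key : ∀ (L : LinearOrder E) (σ : Arrival E),
      σ i ∈ greedyImproving M p τ L σ ↔ σ i ∈ greedySet M p τ L σ (i + 1) := by
    intro L σ
    constructor
    · have hall : ∀ k, σ i ∈ greedySet M p τ L σ k → σ i ∈ greedySet M p τ L σ (i + 1) := by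
        intro k
        induction k with
        | zero => intro h; simp [greedySet] at h
        | succ k ih =>
          intro h
          rcases Nat.lt_or_ge i k with hik | hik
          · refine ih ?_
            rw [greedySet] at h
            split_ifs at h with h1 h2
            · rcases h with h | h
              · have := σ.injective h
                rw [Fin.ext_iff] at this
                simp at this
                omega
              · exact h
            · exact h
            · exact h
          · exact greedySet_mono (by omega) h
      exact hall _
    · exact fun h => greedySet_mono i.2 h
  rw [key, greedySet_online hσ hL hE le_rfl, hσ i le_rfl, key L' σ']

omit hL hE in
-- Assigned times increase with position, so once an unsampled element arrives the sample is
-- complete and already revealed.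
lemma sample_online (hi : σ i ∉ sample p τ σ) : sample p τ σ = sample p τ σ' := by
  have key : ∀ j, (τ (Tuple.sort τ j) : ℝ) < p → j ≤ i := by
    intro j hj
    by_contra! hlt
    refine hi ?_
    simp only [sample, arrivalTime, mem_ofPred_eq, Equiv.symm_apply_apply]
    exact lt_of_le_of_lt (Tuple.monotone_sort τ hlt.le) hj
  ext y
  simp only [sample, arrivalTime, mem_ofPred_eq]
  constructor
  · intro h
    have := hσ _ (key _ h)
    rw [Equiv.apply_symm_apply] at this
    conv_lhs => rw [this]
    simpa using h
  · intro h
    have := hσ _ (key _ h)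
    rw [Equiv.apply_symm_apply] at this
    conv_lhs => rw [← this]
    simpa using h

lemma firstClass_online (hi : σ i ∉ sample p τ σ) :
    firstClass M p τ L σ = firstClass M p τ L' σ' := by
  have hsub : ∀ a ∈ sample p τ σ, σ.symm a ≤ i := by
    intro a ha
    by_contra! hlt
    refine hi ?_
    simp only [sample, arrivalTime, mem_ofPred_eq, Equiv.symm_apply_apply] at ha ⊢
    exact lt_of_le_of_lt (Tuple.monotone_sort τ hlt.le) ha
  have hlt : ∀ a ∈ sample p τ σ, ∀ b ∈ sample p τ σ, (L.lt a b ↔ L'.lt a b) := by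
    intro a ha b hb
    simpa using hL _ (hsub a ha) _ (hsub b hb)
  have hopt : opt M L (sample p τ σ) = opt M L' (sample p τ σ) := opt_congr hE hlt
  ext y
  simp only [firstClass, mem_ofPred_eq]
  rw [← sample_online hσ hi, ← hopt]
  refine exists_congr fun g => and_congr_right fun hg => and_congr_left fun _ => ?_
  refine forall_congr' fun h => forall_congr' fun hh => forall_congr' fun _ => ?_
  exact hlt _ (opt_subset hE _ hh) _ (opt_subset hE _ hg)

omit hL hE in
lemma mem_firstArriving_online {S S' : Set E} (hS : ∀ j ≤ i, σ j ∈ S ↔ σ j ∈ S') :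
    σ i ∈ firstArriving σ S ↔ σ i ∈ firstArriving σ' S' := by
  have h1 : σ'.symm (σ i) = i := by rw [hσ i le_rfl]; simp
  simp only [firstArriving, mem_ofPred_eq, h1, Equiv.symm_apply_apply]
  refine and_congr (hS i le_rfl) ⟨fun h f hf => ?_, fun h f hf => ?_⟩
  · by_contra! hlt
    have h2 := hσ _ hlt.le
    rw [Equiv.apply_symm_apply] at h2
    have h3 := h (σ (σ'.symm f)) ((hS _ hlt.le).2 (by rw [h2]; exact hf))
    rw [Equiv.symm_apply_apply] at h3
    exact absurd hlt (not_lt_of_ge h3)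
  · by_contra! hlt
    have h2 := hσ _ hlt.le
    rw [Equiv.apply_symm_apply] at h2
    have h3 := h f (by
      have := (hS _ hlt.le)
      rw [Equiv.apply_symm_apply] at this
      exact this.1 hf)
    rw [h2, Equiv.symm_apply_apply] at h3
    exact absurd hlt (not_lt_of_ge h3)

lemma mem_obliviousPartition_online :
    σ i ∈ obliviousPartition M p τ L σ ↔ σ i ∈ obliviousPartition M p τ L' σ' := by
  -- While still sampling, the first class may depend on the future, but a sampled element is never
  -- a candidate.
  by_cases hi : σ i ∈ sample p τ σ
  · have h1 : σ i ∉ candidates M p τ L σ := by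
      rw [candidates_eq]; exact fun h => h.1 hi
    have h2 : σ i ∉ candidates M p τ L' σ' := by
      rwa [← mem_candidates_congr hσ hL hE le_rfl]
    simp [obliviousPartition, firstArriving, h1, h2]
  · rw [obliviousPartition, obliviousPartition, firstClass_online hσ hL hE hi]
    refine or_congr (mem_firstArriving_online hσ fun j hj => ?_)
      (mem_firstArriving_online hσ fun j hj => ?_)
    · exact and_congr_left' (mem_candidates_congr hσ hL hE hj)
    · exact and_congr_left' (mem_candidates_congr hσ hL hE hj)

end Online

lemma firstArriving_subsingleton (S : Set E) : (firstArriving σ S).Subsingleton := by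
  intro a ha b hb
  exact σ.symm.injective (le_antisymm (ha.2 b hb.1) (hb.2 a ha.1))

lemma indep_obliviousPartition (hE : M.E = univ) (hloop : M.Loopless) :
    M.Indep (obliviousPartition M p τ L σ) := by
  rw [obliviousPartition]
  rcases (firstArriving_subsingleton (σ := σ)
    (candidates M p τ L σ ∩ firstClass M p τ L σ)).eq_empty_or_singleton with h1 | ⟨a, h1⟩
  · rw [h1, empty_union]
    exact M.subsingleton_indep (firstArriving_subsingleton _) (by simp [hE])
  rcases (firstArriving_subsingleton (σ := σ)
    (candidates M p τ L σ \ firstClass M p τ L σ)).eq_empty_or_singleton with h2 | ⟨b, h2⟩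
  · rw [h2, union_empty]
    exact M.subsingleton_indep (firstArriving_subsingleton _) (by simp [hE])
  rw [h1, h2, singleton_union]
  have ha : a ∈ firstClass M p τ L σ := by
    have : a ∈ firstArriving σ (candidates M p τ L σ ∩ firstClass M p τ L σ) := h1 ▸ rfl
    exact this.1.2
  have hb : b ∉ firstClass M p τ L σ := by
    have : b ∈ firstArriving σ (candidates M p τ L σ \ firstClass M p τ L σ) := h2 ▸ rfl
    exact this.1.2
  -- The first class is closed under parallelism, so the two selected elements cannot be parallel.
  refine indep_pair hE hloop fun hab => hb ?_
  obtain ⟨g, hg, hmax, hag⟩ := ha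
  refine ⟨g, hg, hmax, ?_⟩
  rw [eq_or_parallel_iff hE hloop] at hag ⊢
  exact mem_closure_singleton_trans (mem_closure_singleton_symm hE hloop hab) hag

lemma isMSPAlgorithm_mixture (hE : M.E = univ) (hloop : M.Loopless) (p ε : ℝ) :
    (mixture M p ε).IsMSPAlgorithm M where
  isProbabilityMeasure := by
    change IsProbabilityMeasure (volume : Measure (unitInterval × (Fin (Fintype.card E) →
      unitInterval)))
    infer_instance
  measurableSet_mem_output L σ e := by
    rw [setOf_mem_output_mixture]
    exact ((measurableSet_coe_lt ε).prod (measurableSet_mem_obliviousPartition L σ e)).union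
      ((measurableSet_coe_lt ε).compl.prod (measurableSet_mem_greedyImproving L σ e))
  online := by
    rintro ⟨u, τ⟩ L L' σ σ' i hσ hL
    rw [← hσ i le_rfl]
    by_cases h : (u : ℝ) < ε
    · simpa [mixture, h] using mem_obliviousPartition_online hσ hL hE
    · simpa [mixture, h] using mem_greedyImproving_online hσ hL hE
  indep_output := by
    rintro ⟨u, τ⟩ L σ
    by_cases h : (u : ℝ) < ε
    · simpa [mixture, h] using indep_obliviousPartition hE hloop
    · simpa [mixture, h, greedyImproving] using indep_greedySet _

end Algorithm

/-! ### Transfer from independent times to random order, and conclusion. -/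

section Main

open Function

variable {E : Type*} [Fintype E]

/-- The arrival times of all elements. -/
noncomputable def times (τ : Fin (Fintype.card E) → unitInterval) (σ : Arrival E) : E → unitInterval :=
  fun y => τ (Tuple.sort τ (σ.symm y))

lemma hasTimes_times {τ : Fin (Fintype.card E) → unitInterval} {σ : Arrival E}
    (hinj : Injective (times τ σ)) : HasTimes τ σ (times τ σ) where
  time_eq _ := rfl
  symm_le y z := by
    have hmono : Monotone (τ ∘ Tuple.sort τ) := Tuple.monotone_sort τ
    have hs : StrictMono (τ ∘ Tuple.sort τ) := by
      refine hmono.strictMono_of_injective fun i j hij => ?_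
      apply σ.injective
      apply hinj
      simpa [times] using hij
    exact (hs.le_iff_le (a := σ.symm y) (b := σ.symm z)).symm

lemma volume_preimage_comp_equiv (ρ : E ≃ Fin (Fintype.card E)) (S : Set (E → unitInterval)) :
    volume {τ : Fin (Fintype.card E) → unitInterval | (fun y => τ (ρ y)) ∈ S} = volume S := by
  have h := (volume_preserving_arrowCongr' ρ.symm (MeasurableEquiv.refl unitInterval)
    (MeasurePreserving.id volume)).measure_preimage_equiv S
  exact h

/-- Split the seeds by their sorting permutation π. For fixed π, composing with π permutes the
arrival orders, so the sum may run over all bijections ρ from elements to coordinates; for each ρ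
the times are independent and uniform, and there are n! of them. -/
lemma factorial_mul_volume_le [DecidableEq E] (S : Set (E → unitInterval)) :
    ((Fintype.card E).factorial : ENNReal) * volume S ≤
      ∑ σ : Arrival E, volume {τ | times τ σ ∈ S} := by
  have h1 : ∀ σ : Arrival E, ∑ π : Equiv.Perm (Fin (Fintype.card E)),
      volume ({τ : Fin (Fintype.card E) → unitInterval | (fun y => τ (π (σ.symm y))) ∈ S} ∩
        {τ | Tuple.sort τ = π}) ≤ volume {τ | times τ σ ∈ S} := by
    intro σ
    refine le_trans (Finset.sum_le_sum fun π _ => measure_mono ?_)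
      (sum_measure_inter_le volume {τ | times τ σ ∈ S} Finset.univ
      (fun π : Equiv.Perm (Fin (Fintype.card E)) => {τ | Tuple.sort τ = π})
      (fun π _ => measurableSet_sort_eq π) ?_)
    · rintro τ ⟨h, rfl⟩
      exact ⟨h, rfl⟩
    · intro π _ π' _ hne
      rw [Function.onFun, Set.disjoint_left]
      rintro τ rfl rfl
      exact hne rfl
  refine le_trans ?_ (Finset.sum_le_sum fun σ _ => h1 σ)
  rw [Finset.sum_comm]
  have h2 : ∀ π : Equiv.Perm (Fin (Fintype.card E)), ∑ σ : Arrival E,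
      volume ({τ : Fin (Fintype.card E) → unitInterval | (fun y => τ (π (σ.symm y))) ∈ S} ∩
        {τ | Tuple.sort τ = π}) = ∑ ρ : E ≃ Fin (Fintype.card E),
      volume ({τ : Fin (Fintype.card E) → unitInterval | (fun y => τ (ρ y)) ∈ S} ∩
        {τ | Tuple.sort τ = π}) := by
    intro π
    let F : Arrival E ≃ (E ≃ Fin (Fintype.card E)) :=
      ⟨fun σ => σ.symm.trans π, fun ρ => (ρ.trans π.symm).symm, fun σ => by ext; simp,
        fun ρ => by ext; simp⟩
    exact Fintype.sum_equiv F _ _ fun σ => rfl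
  rw [Finset.sum_congr rfl fun π _ => h2 π, Finset.sum_comm]
  have h3 : ∀ ρ : E ≃ Fin (Fintype.card E), volume S ≤
      ∑ π : Equiv.Perm (Fin (Fintype.card E)),
      volume ({τ : Fin (Fintype.card E) → unitInterval | (fun y => τ (ρ y)) ∈ S} ∩
        {τ | Tuple.sort τ = π}) := by
    intro ρ
    rw [← volume_preimage_comp_equiv ρ S]
    refine le_trans (measure_mono ?_) (measure_iUnion_fintype_le _ _)
    intro τ hτ
    exact mem_iUnion.2 ⟨Tuple.sort τ, hτ, rfl⟩
  refine le_trans ?_ (Finset.sum_le_sum fun ρ _ => h3 ρ)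
  rw [Finset.sum_const, Finset.card_univ, Fintype.card_equiv (Fintype.equivFin E), nsmul_eq_mul]

lemma volume_not_injective : volume {x : E → unitInterval | ¬ Injective x} = 0 := by
  classical
  have hsub : {x : E → unitInterval | ¬ Injective x} ⊆ ⋃ (y : E) (z : E) (_ : y ≠ z), {x | x y = x z} := by
    intro x hx
    simp only [mem_ofPred_eq, Injective, not_forall] at hx
    obtain ⟨y, z, h, hne⟩ := hx
    simp only [mem_iUnion]
    exact ⟨y, z, hne, h⟩
  refine measure_mono_null hsub ?_
  simp only [measure_iUnion_null_iff]
  intro y z hne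
  have hm : MeasurableSet {x : E → unitInterval | x y = x z} :=
    measurableSet_eq_fun (measurable_pi_apply y) (measurable_pi_apply z)
  rw [← (measurePreserving_update y).measure_preimage hm.nullMeasurableSet,
    Measure.measure_prod_null ((measurePreserving_update y).measurable hm)]
  refine Filter.Eventually.of_forall fun x => ?_
  have : Prod.mk x ⁻¹' ((fun w : (E → unitInterval) × unitInterval => update w.1 y w.2) ⁻¹' {x | x y = x z}) = {x z} := by
    ext t
    simp [hne.symm]
  change volume (Prod.mk x ⁻¹' ((fun w : (E → unitInterval) × unitInterval => update w.1 y w.2) ⁻¹'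
    {x | x y = x z})) = 0
  rw [this]
  simp

lemma volume_le_sum_of_hasTimes [DecidableEq E] {S : Set (E → unitInterval)}
    {T : Arrival E → Set (Fin (Fintype.card E) → unitInterval)}
    (h : ∀ x ∈ S, ∀ τ σ, HasTimes τ σ x → τ ∈ T σ) :
    ((Fintype.card E).factorial : ENNReal) * volume S ≤ ∑ σ : Arrival E, volume (T σ) := by
  -- Ties have probability zero; away from them the assigned times order the elements exactly as
  -- they arrive.
  have h1 : volume S = volume (S \ {x | ¬ Injective x}) :=
    (measure_sdiff_null volume_not_injective).symm
  rw [h1]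
  refine (factorial_mul_volume_le _).trans (Finset.sum_le_sum fun σ _ => measure_mono ?_)
  rintro τ ⟨hτ, hinj⟩
  exact h _ hτ τ σ (hasTimes_times (not_not.1 hinj))

lemma integral_le_volume [DecidableEq E] {e : E} {p : unitInterval} {S : Set (E → unitInterval)} {h : ℝ → ℝ}
    (hc : ContinuousOn h (Icc p 1)) (hnn : ∀ t ∈ Icc (p : ℝ) 1, 0 ≤ h t)
    (hle : ∀ t : unitInterval, p ≤ t → ENNReal.ofReal (h t) ≤ volume {x | update x e t ∈ S}) :
    ENNReal.ofReal (∫ t in (p : ℝ)..1, h t) ≤ volume S := by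
  refine le_trans ?_ (lintegral_measure_update_le e S)
  rw [← setLIntegral_unitInterval p.2.1 p.2.2 le_rfl hc hnn]
  refine le_trans (setLIntegral_mono_ae' ?_ (Filter.Eventually.of_forall fun s hs => ?_))
    (setLIntegral_le_lintegral (((↑) : unitInterval → ℝ) ⁻¹' Ico (p : ℝ) 1) _)
  · exact measurable_subtype_coe measurableSet_Ico
  · exact hle s hs.1

lemma le_average_real [DecidableEq E] {S : Set (E → unitInterval)} {T : Arrival E → Set (Fin (Fintype.card E) → unitInterval)}
    (h : ∀ x ∈ S, ∀ τ σ, HasTimes τ σ x → τ ∈ T σ) {c : ℝ} (hc : ENNReal.ofReal c ≤ volume S) :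
    c ≤ (∑ σ : Arrival E, volume.real (T σ)) / (Fintype.card E).factorial := by
  have h1 := (mul_le_mul_right hc ((Fintype.card E).factorial : ENNReal)).trans
    (volume_le_sum_of_hasTimes h)
  have hpos : (0 : ℝ) < (Fintype.card E).factorial := by exact_mod_cast Nat.factorial_pos _
  rw [le_div_iff₀ hpos]
  have hsum : ∑ σ : Arrival E, volume.real (T σ) = (∑ σ : Arrival E, volume (T σ)).toReal :=
    (ENNReal.toReal_sum fun σ _ => measure_ne_top _ _).symm
  rw [hsum]
  rw [← ENNReal.ofReal_natCast, ← ENNReal.ofReal_mul hpos.le] at h1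
  rw [mul_comm]
  exact (ENNReal.ofReal_le_iff_le_toReal
    (ENNReal.sum_ne_top.2 fun σ _ => measure_ne_top _ _)).1 h1

lemma volume_coe_lt {ε : ℝ} (h0 : 0 ≤ ε) (h1 : ε ≤ 1) :
    volume.real {u : unitInterval | (u : ℝ) < ε} = ε := by
  have : {u : unitInterval | (u : ℝ) < ε} = Iio (⟨ε, h0, h1⟩ : unitInterval) := rfl
  rw [this, measureReal_def, unitInterval.volume_Iio]
  exact ENNReal.toReal_ofReal h0

open scoped Classical in
lemma selectionProb_mixture (M : Matroid E) (p : ℝ) {ε : ℝ} (h0 : 0 ≤ ε) (h1 : ε ≤ 1)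
    (L : LinearOrder E) (e : E) :
    (mixture M p ε).selectionProb L e =
      ε * ((∑ σ : Arrival E, volume.real {τ | e ∈ obliviousPartition M p τ L σ}) /
        (Fintype.card E).factorial) +
      (1 - ε) * ((∑ σ : Arrival E, volume.real {τ | e ∈ greedyImproving M p τ L σ}) /
        (Fintype.card E).factorial) := by
  have hlaw : ∀ σ : Arrival E, (mixture M p ε).law.real {ω | e ∈ (mixture M p ε).output ω L σ} =
      ε * volume.real {τ | e ∈ obliviousPartition M p τ L σ} +
      (1 - ε) * volume.real {τ | e ∈ greedyImproving M p τ L σ} := by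
    intro σ
    rw [setOf_mem_output_mixture]
    change ((volume : Measure unitInterval).prod (volume : Measure (Fin (Fintype.card E) → unitInterval))).real _ = _
    rw [measureReal_union, measureReal_prod_prod, measureReal_prod_prod, volume_coe_lt h0 h1,
      probReal_compl_eq_one_sub (measurableSet_coe_lt ε), volume_coe_lt h0 h1]
    · rw [Set.disjoint_left]
      exact fun ω h h' => h'.1 h.1
    · exact (measurableSet_coe_lt ε).compl.prod (measurableSet_mem_greedyImproving L σ e)
  rw [RandomizedProcedure.selectionProb]
  simp only [hlaw]
  rw [Finset.sum_add_distrib, ← Finset.mul_sum, ← Finset.mul_sum]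
  ring

open scoped Classical in
/-- The optimum of a finite set, as a finite set. -/
noncomputable def optFinset (M : Matroid E) (L : LinearOrder E) (A : Finset E) : Finset E :=
  Finset.univ.filter fun y => y ∈ opt M L A

variable {M : Matroid E} (hE : M.E = univ) {L : LinearOrder E}

lemma mem_optFinset {A : Finset E} {y : E} : y ∈ optFinset M L A ↔ y ∈ opt M L A := by
  simp [optFinset]

lemma coe_before (x : E → unitInterval) (a : unitInterval) : ((before x a : Finset E) : Set E) = {y | x y < a} := by
  ext; simp

include hE

lemma optFinset_subset (A : Finset E) : optFinset M L A ⊆ A := fun y hy => by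
  rw [mem_optFinset] at hy
  exact_mod_cast opt_subset hE _ hy

lemma card_optFinset_le (hrank : M.eRank = 2) (A : Finset E) : (optFinset M L A).card ≤ 2 := by
  have h := (indep_opt hE (L := L) (A : Set E)).encard_le_eRank
  have heq : opt M L A = (optFinset M L A : Set E) := by
    ext y
    rw [Finset.mem_coe, mem_optFinset]
  rw [hrank, heq, Set.encard_coe_eq_coe_finsetCard] at h
  exact_mod_cast h

lemma isProbabilityCompetitive_mixture (hloop : M.Loopless) (hrank : M.eRank = 2) :
    (mixture M 0.4067 0.3928).IsProbabilityCompetitive M 0.3462 := by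
  classical
  intro L e he
  rw [selectionProb_mixture M _ (by norm_num) (by norm_num)]
  let p : unitInterval := ⟨0.4067, by norm_num, by norm_num⟩
  have hp : (p : ℝ) = 0.4067 := rfl
  have hp0 : 0 < (p : ℝ) := by rw [hp]; norm_num
  let K : Finset E := Finset.univ.filter fun f => f ∈ M.closure {e}
  let O : Finset E → Finset E := optFinset M L
  have hO : ∀ A, O A ⊆ A := optFinset_subset hE
  have hcard : ∀ A, (O A).card ≤ 2 := card_optFinset_le hE hrank
  have hK : ∀ A, (O A ∩ K).card ≤ 1 := by
    intro A
    rw [Finset.card_le_one]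
    intro a ha b hb
    by_contra hne
    simp only [O, K, Finset.mem_inter, mem_optFinset, Finset.mem_filter, Finset.mem_univ,
      true_and] at ha hb
    have hab : a ∈ M.closure {b} :=
      mem_closure_singleton_trans ha.2 (mem_closure_singleton_symm hE hloop hb.2)
    refine (indep_opt hE (L := L) (A : Set E)).notMem_closure_sdiff_of_mem ha.1
      (M.closure_subset_closure ?_ hab)
    exact singleton_subset_iff.2 ⟨hb.1, Ne.symm hne⟩
  have hO' : ∀ x a y, y ∈ O (before x a) ↔ y ∈ opt M L {y | x y < a} := fun x a y => by
    rw [← coe_before, ← mem_optFinset]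
  have hφc := continuous_meetProb O K e
  have hφ0 : ∀ t ∈ Icc (0.4067 : ℝ) 1, 0 ≤ meetProb O K e t := fun t ht =>
    meetProb_nonneg O K e (le_trans (by norm_num) ht.1) ht.2
  have hφ1 : ∀ t ∈ Icc (0.4067 : ℝ) 1, meetProb O K e t ≤ 1 := fun t ht =>
    meetProb_le_one O K e (le_trans (by norm_num) ht.1) ht.2
  -- Quantifying over every seed and order that realize the times x makes selection an event in x
  -- alone, possibly not measurable.
  let S₁ : Set (E → unitInterval) := {x | ∀ τ σ, HasTimes τ σ x → e ∈ obliviousPartition M 0.4067 τ L σ}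
  let S₂ : Set (E → unitInterval) := {x | ∀ τ σ, HasTimes τ σ x → e ∈ greedyImproving M 0.4067 τ L σ}
  let h₁ : ℝ → ℝ := fun t => meetProb O K e t * (0.4067 / t) +
    (1 - meetProb O K e t) * (0.4067 / t) ^ 2
  let h₂ : ℝ → ℝ := fun t => (0.4067 / t) ^ 2 *
    (1 + (2 - meetProb O K e t) * Real.log (t / 0.4067))
  have hsub : Icc (0.4067 : ℝ) 1 ⊆ Ioi 0 := fun t ht => lt_of_lt_of_le (by norm_num) ht.1
  have hc₁ : ContinuousOn h₁ (Icc 0.4067 1) :=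
    ((hφc.continuousOn.mul continuousOn_ratio).add
      ((continuousOn_const.sub hφc.continuousOn).mul (continuousOn_ratio.pow 2))).mono hsub
  have hc₂ : ContinuousOn h₂ (Icc 0.4067 1) :=
    ((continuousOn_ratio.pow 2).mul (continuousOn_const.add
      ((continuousOn_const.sub hφc.continuousOn).mul continuousOn_log_ratio))).mono hsub
  have hb₁ : ENNReal.ofReal (∫ t in (0.4067 : ℝ)..1, h₁ t) ≤ volume S₁ := by
    refine integral_le_volume (e := e) (p := p) hc₁ (fun t ht => ?_) fun t ht => ?_
    · have h1 := hφ0 t ht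
      have h2 := hφ1 t ht
      have h3 : 0 < t := hsub ht
      exact add_nonneg (mul_nonneg h1 (by positivity))
        (mul_nonneg (by linarith) (by positivity))
    · refine oblivious_lower_bound_at hO hp0 ?_ hcard (K := K) ?_ ht
      · intro x hpx hx τ σ hτ
        exact hτ.mem_obliviousPartition_of_opt_subset_sample hE he hpx
          fun y hy => hx y ((hO' _ _ _).2 hy)
      · intro x g hpx hg hgK hgp τ σ hτ
        exact hτ.mem_obliviousPartition_of_parallel hE he hloop hrank hpx ((hO' _ _ _).1 hg)
          (by simpa [K] using hgK) hgp
  have hb₂ : ENNReal.ofReal (∫ t in (0.4067 : ℝ)..1, h₂ t) ≤ volume S₂ := by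
    refine integral_le_volume (e := e) (p := p) hc₂ (fun t ht => ?_) fun t ht => ?_
    · have h2 := hφ1 t ht
      have h3 : 0 < t := hsub ht
      have h4 : 0 ≤ Real.log (t / 0.4067) :=
        Real.log_nonneg ((one_le_div (by norm_num)).2 ht.1)
      exact mul_nonneg (by positivity) (add_nonneg zero_le_one
        (mul_nonneg (by linarith) h4))
    · refine greedy_lower_bound_at hO hp0 ?_ hcard (K := K) hK ?_ ht
      · intro x hpx hx τ σ hτ
        exact hτ.mem_greedyImproving_of_opt_subset_sample hE he hloop hpx
          fun y hy => hx y ((hO' _ _ _).2 hy)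
      · intro x f hpx hf hfK _ hfirst hB τ σ hτ
        exact hτ.mem_greedyImproving_of_unique hE he hloop hpx ((hO' _ _ _).1 hf)
          (by simpa [K] using hfK) (fun y hy => hfirst y ((hO' _ _ _).2 hy))
          fun y hy => hB y ((hO' _ _ _).2 hy)
  have hle₁ := le_average_real (S := S₁) (T := fun σ => {τ | e ∈ obliviousPartition M 0.4067 τ L σ})
    (fun x hx τ σ hτ => hx τ σ hτ) hb₁
  have hle₂ := le_average_real (S := S₂) (T := fun σ => {τ | e ∈ greedyImproving M 0.4067 τ L σ})
    (fun x hx τ σ hτ => hx τ σ hτ) hb₂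
  have hfinal := mixture_integral_bound hφc hφ0 hφ1
  have hi₁ : IntervalIntegrable h₁ volume 0.4067 1 :=
    (hc₁.mono (by rw [uIcc_of_le (by norm_num)])).intervalIntegrable
  have hi₂ : IntervalIntegrable h₂ volume 0.4067 1 :=
    (hc₂.mono (by rw [uIcc_of_le (by norm_num)])).intervalIntegrable
  -- The mixed integrand is affine in the meeting probability, with `meetBound` and `avoidBound` as
  -- its values at 1 and 0.
  have heq : ∫ t in (0.4067 : ℝ)..1, (meetProb O K e t * meetBound t +
      (1 - meetProb O K e t) * avoidBound t) =
      0.3928 * (∫ t in (0.4067 : ℝ)..1, h₁ t) + (1 - 0.3928) * ∫ t in (0.4067 : ℝ)..1, h₂ t := by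
    rw [← intervalIntegral.integral_const_mul, ← intervalIntegral.integral_const_mul,
      ← intervalIntegral.integral_add (hi₁.const_mul _) (hi₂.const_mul _)]
    congr 1
    ext t
    simp only [h₁, h₂, meetBound, avoidBound]
    ring
  rw [heq] at hfinal
  refine hfinal.trans (add_le_add (mul_le_mul_of_nonneg_left hle₁ (by norm_num))
    (mul_le_mul_of_nonneg_left hle₂ (by norm_num)))

end Main

end MSP

theorem theorem2 {E : Type*} [Fintype E] (M : Matroid E) (hE : M.E = Set.univ)
    (hloopless : M.Loopless) (hrank : M.eRank = 2) :
    (MSP.mixture M 0.4067 0.3928).IsMSPAlgorithm M ∧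
      (MSP.mixture M 0.4067 0.3928).IsProbabilityCompetitive M 0.3462 :=
  ⟨MSP.isMSPAlgorithm_mixture hE hloopless _ _,
    MSP.isProbabilityCompetitive_mixture hE hloopless hrank⟩
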